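/- Let $\theta>0$, $L>0$, $\nu\ge 0$, $\lambda\ge 0$. Let $U,D:[0,\infty)\to\mathbb R$ be continuous, strictly increasing, twice differentiable on $(0,\infty)$, with $U(0)=D(0)=0$; let $U''<0$ on $(0,\infty)$, $U'(0+)=\infty$ and $U'(\infty)=0$. Put $$f_\nu(x)=U((x-\theta)_+)-\nu D((\theta-x)_+),\quad f(x)=f_\nu(x)+\lambda 1_{x\ge L},\quad k=\frac{f_\nu(L)+\lambda+\nu D(\theta)}{L},$$ and let $I_1=(U')^{-1}$, $I_2=(D')^{-1}$ (inverses on $(0,\infty)$). Write $G(y)=I_1(y)+\theta$ and $H(y)=\theta-I_2(y/\nu)$. For functions $g_1,\dots,g_n$ (constants allowed) and numbers $b_1,\dots,b_n$, we say that "the solution is $[g_1|b_1|g_2|b_2|\cdots|g_n|b_n|0]$" if $0<b_1\le\dots\le b_n$ and the function $x^*(y)$ equal to $g_1$ on $0<y<b_1$, to $g_i$ on $b_{i-1}\le y<b_i$ and to $0$ on $y\ge b_n$ has the following property: for every $y>0$, $x^*(y)\ge 0$ is a maximiser of $f(x)-yx$ over $x\ge0$, and it is the only one unless $y\in\{b_1,\dots,b_n\}$.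 For $\mu\ge0$, a *$\mu$-pair* is a pair $(a,b)$ with $a<\theta<b$ and $$\nu D'(\theta-a)=U'(b-\theta)=\frac{U(b-\theta)+\mu+\nu D(\theta-a)}{(b-\theta)+(\theta-a)}.$$ For every $\mu\ge0$ there is a unique $\zeta_\mu>\theta$ with $U'(\zeta_\mu-\theta)=\frac{U(\zeta_\mu-\theta)+\mu+\nu D(\theta)}{\zeta_\mu}$. **A. $D$ strictly convex.** For each $\mu\ge 0$ there is at most one $\mu$-pair, and there is one if $\nu>0$ and $D'(\infty)=\infty$. Denote by $(z_1,z_2)$ the $0$-pair and by $(z_6,z_7)$ the $\lambda$-pair; when such a pair does not exist, read $z_1=-\infty$, respectively $z_6=-\infty$ (and claims on $z_2$, $z_7$ are void). *$\lambda=0$.* - (I) If $z_1\ge0$: $[G|U'(z_2-\theta)|H|\nu D'(\theta)|0]$. - (II) If $z_1<0$: $[G|U'(\zeta_0-\theta)|0]$. *$\lambda>0$, $L<z_1$.* - (III) If $k>\nu D'(\theta)$: $[G|U'(z_2-\theta)|H|\nu D'(\theta-L)|L|k|0]$. - (IV) If $k\le\nu D'(\theta)$, there is a unique $z_3\in[0,L)$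 with $\nu D'(\theta-z_3)=\frac{f_\nu(L)+\lambda+\nu D(\theta-z_3)}{L-z_3}$, and the solution is $[G|U'(z_2-\theta)|H|\nu D'(\theta-L)|L|\nu D'(\theta-z_3)|H|\nu D'(\theta)|0]$. *$\lambda>0$, $z_1\le L<\theta$.* There is a unique $z_4>\theta$ with $U'(z_4-\theta)=\frac{U(z_4-\theta)+\nu D(\theta-L)}{z_4-L}$. - (V) If $k>\nu D'(\theta)$ and $k>U'(z_4-\theta)$: $[G|U'(z_4-\theta)|L|k|0]$. - (VI) If $\nu D'(\theta)<k\le U'(z_4-\theta)$: $[G|U'(\zeta_\lambda-\theta)|0]$. - If $k\le\nu D'(\theta)$, there is a unique $z_3\in[0,L)$ as in (IV). (VII) If $\nu D'(\theta-z_3)>U'(z_4-\theta)$: $[G|U'(z_4-\theta)|L|\nu D'(\theta-z_3)|H|\nu D'(\theta)|0]$. (VIII) If $\nu D'(\theta-z_3)\le U'(z_4-\theta)$, then $z_6<L$; if $z_6>0$: $[G|U'(z_7-\theta)|H|\nu D'(\theta)|0]$; if $z_6\le0$: the solution of (VI). *$\lambda>0$, $L=\theta$.* If $z_6>0$: the solution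 of (VIII) for $z_6>0$; if $z_6\le0$: the solution of (VI). *$\lambda>0$, $L>\theta$.* There is a unique $z_8\in(\theta,L)$ with $U'(z_8-\theta)=\frac{U(L-\theta)+\lambda-U(z_8-\theta)}{L-z_8}$. If $k>\nu D'(\theta)$: - (IX) If $U'(z_8-\theta)>k\ge U'(L-\theta)$: $[G|U'(L-\theta)|L|k|0]$. - (X) If $k<U'(L-\theta)$: $\zeta_\lambda>L$ and $[G|U'(\zeta_\lambda-\theta)|0]$. - (XI) If $k\ge U'(z_8-\theta)$: $\zeta_0\le z_8$ and $[G|U'(L-\theta)|L|U'(z_8-\theta)|G|U'(\zeta_0-\theta)|0]$. If $k\le\nu D'(\theta)$, there is at most one $z_{11}\in[0,\theta)$ with $\nu D'(\theta-z_{11})=\frac{U(L-\theta)+\lambda+\nu D(\theta-z_{11})}{L-z_{11}}$; it exists if and only if $\nu D'(0+)(L-\theta)<U(L-\theta)+\lambda$ (in particular if $D'(0+)=0$). - (XII) If $z_{11}$ exists and $U'(z_8-\theta)\ge\nu D'(\theta-z_{11})\ge U'(L-\theta)$: $[G|U'(L-\theta)|L|\nu D'(\theta-z_{11})|H|\nu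 D'(\theta)|0]$. - (XIII) If $z_{11}$ does not exist or $U'(z_8-\theta)<\nu D'(\theta-z_{11})$: then $z_2<z_8$ (if the $0$-pair exists); if $z_1\ge0$: $[G|U'(L-\theta)|L|U'(z_8-\theta)|G|U'(z_2-\theta)|H|\nu D'(\theta)|0]$; if $z_1<0$: $\zeta_0\le z_8$ and the solution is that of (XI). - (XIV) If $z_{11}$ exists and $U'(L-\theta)>\nu D'(\theta-z_{11})$: then $z_7>L$ (if the $\lambda$-pair exists); if $z_6>0$: $[G|U'(z_7-\theta)|H|\nu D'(\theta)|0]$; if $z_6\le0$: $\zeta_\lambda>L$ and the solution is that of (X). **B. $D$ concave.** Put $z=\zeta_0$. *$L\ge z$.* Then $k\ge U'(L-\theta)$. - (I) If $k>U'(z-\theta)$: $[G|U'(L-\theta)|L|k|0]$. - (II) If $k\le U'(z-\theta)$, there is a unique $L_0\in[z,L]$ with $U(L-\theta)+\lambda-U(L_0-\theta)=(L-L_0)U'(L_0-\theta)$, and the solution is $[G|U'(L-\theta)|L|U'(L_0-\theta)|G|U'(z-\theta)|0]$. *$\theta\le L<z$* (with $U'(0)=\infty$). - (III) If $k\ge U'(L-\theta)$: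 $[G|U'(L-\theta)|L|k|0]$. - (IV) If $k<U'(L-\theta)$, there is a unique $\tilde z_0\in(L,z]$ with $U(\tilde z_0-\theta)+\lambda+\nu D(\theta)=\tilde z_0U'(\tilde z_0-\theta)$, and the solution is $[G|U'(\tilde z_0-\theta)|0]$. *$L<\theta$.* There is a unique $\hat z\in(\theta,z)$ with $U(\hat z-\theta)+\nu D(\theta-L)=(\hat z-L)U'(\hat z-\theta)$. - (V) If $k>U'(\hat z-\theta)$: $[G|U'(\hat z-\theta)|L|k|0]$. - (VI) If $k\le U'(\hat z-\theta)$, there is a unique $\hat z_0\in[\hat z,z]$ with $U(\hat z_0-\theta)+\lambda+\nu D(\theta)=\hat z_0U'(\hat z_0-\theta)$, and the solution is $[G|U'(\hat z_0-\theta)|0]$. -/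

import Mathlib

open Set Filter Topology

namespace RatioVaR

/-- The standing conditions on the reward function, as a function on `[0, ∞)` (values at negative
arguments are irrelevant): continuous, twice differentiable on `(0, ∞)`, strictly increasing,
`U(0) = 0`, the Inada conditions `U'(0+) = ∞`, `U'(∞) = 0`, and `U'' < 0` on `(0, ∞)`. -/
structure IsReward (U : ℝ → ℝ) : Prop where
  continuousOn : ContinuousOn U (Ici 0)
  differentiableOn : DifferentiableOn ℝ U (Ioi 0)
  differentiableOn_deriv : DifferentiableOn ℝ (deriv U) (Ioi 0)
  strictMonoOn : StrictMonoOn U (Ici 0)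
  map_zero : U 0 = 0
  inada_zero : Tendsto (deriv U) (𝓝[>] 0) atTop
  inada_top : Tendsto (deriv U) atTop (𝓝 0)
  deriv2_neg : ∀ x, 0 < x → deriv (deriv U) x < 0

/-- The standing conditions on the penalty function, as a function on `[0, ∞)`: continuous, twice
differentiable on `(0, ∞)`, strictly increasing, `D(0) = 0`. -/
structure IsPenalty (D : ℝ → ℝ) : Prop where
  continuousOn : ContinuousOn D (Ici 0)
  differentiableOn : DifferentiableOn ℝ D (Ioi 0)
  differentiableOn_deriv : DifferentiableOn ℝ (deriv D) (Ioi 0)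
  strictMonoOn : StrictMonoOn D (Ici 0)
  map_zero : D 0 = 0

/-- `f_ν(x) = U((x-θ)_+) - ν D((θ-x)_+)`. -/
def fNu (U D : ℝ → ℝ) (θ ν : ℝ) (x : ℝ) : ℝ :=
  U (max (x - θ) 0) - ν * D (max (θ - x) 0)

/-- `f_{ν,λ}(x) = U((x-θ)_+) - ν D((θ-x)_+) + λ 1_{x ≥ L}`. -/
noncomputable def fNuLam (U D : ℝ → ℝ) (θ L ν lam : ℝ) (x : ℝ) : ℝ :=
  fNu U D θ ν x + lam * (Ici L).indicator (fun _ => (1 : ℝ)) x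

/-- `k_{ν,λ} = (f_ν(L) + λ + ν D(θ)) / L`. -/
noncomputable def kSlope (U D : ℝ → ℝ) (θ L ν lam : ℝ) : ℝ :=
  (fNu U D θ ν L + lam + ν * D θ) / L

/-- `I₁`, the inverse function of `U'` on `(0, ∞)` (and `I₂`, when applied to `D`). -/
noncomputable def derivInv (V : ℝ → ℝ) : ℝ → ℝ :=
  Function.invFunOn (deriv V) (Ioi 0)

/-- The piece `y ↦ I₁(y) + θ`. -/
noncomputable def gainPiece (U : ℝ → ℝ) (θ : ℝ) (y : ℝ) : ℝ := derivInv U y + θ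

/-- The piece `y ↦ θ - I₂(y / ν)`. -/
noncomputable def lossPiece (D : ℝ → ℝ) (θ ν : ℝ) (y : ℝ) : ℝ := θ - derivInv D (y / ν)

/-- The piecewise function with pieces `g₁` on `(0, b₁)`, `g₂` on `[b₁, b₂)`, …, `gₙ` on
`[bₙ₋₁, bₙ)`, given as the list `(g₁, b₁), …, (gₙ, bₙ)`, and the value `0` on `[bₙ, ∞)`. -/
noncomputable def piecewiseFn : List ((ℝ → ℝ) × ℝ) → ℝ → ℝ
  | [], _ => 0
  | (g, b) :: rest, y => if y < b then g y else piecewiseFn rest y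

/-- The piecewise function described by `pieces` solves `max_{x ≥ 0} (f(x) - y x)` for every
`y > 0`: the end points satisfy `0 < b₁ ≤ b₂ ≤ … ≤ bₙ`, the value at `y` is a maximiser over
`[0, ∞)` for every `y > 0`, and it is the only maximiser unless `y` is one of the end points. -/
def IsSolution (f : ℝ → ℝ) (pieces : List ((ℝ → ℝ) × ℝ)) : Prop :=
  (∀ p ∈ pieces, 0 < p.2) ∧
  pieces.Pairwise (fun p q => p.2 ≤ q.2) ∧
  ∀ y, 0 < y →
    0 ≤ piecewiseFn pieces y ∧
    (∀ x, 0 ≤ x → f x - y * x ≤ f (piecewiseFn pieces y) - y * piecewiseFn pieces y) ∧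
    ((∀ p ∈ pieces, y ≠ p.2) → ∀ x, 0 ≤ x →
      f x - y * x = f (piecewiseFn pieces y) - y * piecewiseFn pieces y →
      x = piecewiseFn pieces y)

/-- `a < θ < b` and
`ν D'(θ-a) = U'(b-θ) = (U(b-θ) + μ + ν D(θ-a)) / ((b-θ) + (θ-a))`. -/
def TangentPair (U D : ℝ → ℝ) (θ ν μ a b : ℝ) : Prop :=
  a < θ ∧ θ < b ∧ ν * deriv D (θ - a) = deriv U (b - θ) ∧
    deriv U (b - θ) = (U (b - θ) + μ + ν * D (θ - a)) / ((b - θ) + (θ - a))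

/-- `z > θ` and `U'(z-θ) = (U(z-θ) + μ + ν D(θ)) / z`. -/
def TangentZero (U D : ℝ → ℝ) (θ ν μ z : ℝ) : Prop :=
  θ < z ∧ deriv U (z - θ) = (U (z - θ) + μ + ν * D θ) / z

/-- `z ∈ [0, min(L, θ))` and
`ν D'(θ-z) = (f_ν(L) + λ + ν D(θ-z)) / (L-z)`. -/
def TangentLoss (U D : ℝ → ℝ) (θ L ν lam z : ℝ) : Prop :=
  0 ≤ z ∧ z < min L θ ∧
    ν * deriv D (θ - z) = (fNu U D θ ν L + lam + ν * D (θ - z)) / (L - z)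

end RatioVaR

/-! A point `p` maximises `f x - y * x` exactly when the line of slope `y` through `(p, f p)` lies
above `f`. As `y` grows, the solution therefore follows the contact points of the least concave
majorant of `f` from right to left. On a strictly concave branch of `f` the contact point moves
continuously (the pieces `gainPiece` and `lossPiece`); at a corner, that is at the jump point `(L, f
L)` or at the origin, the supporting line pivots and the piece is constant. A break point is a slope
at which one regime passes into the next, often the slope of a line that touches `f` twice
(`Dominates.of_touch`).

Solutions are assembled from their right end with `SolvesFrom`. The saving is that supporting lines
already known at two contact points control `f` outside the interval between them, so a line of
intermediate slope need only be compared with `f` on that interval, where `f` is a single concave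
branch (`Dominates.strictlyDominates_of_mem`, `Dominates.steeper`, `Dominates.flatter`).

What remains is to decide which double tangents belong to the majorant. All these comparisons use
one device: the height of a tangent above a fixed abscissa is strictly monotone in the contact point
(`IsReward.tangentGap_lt`, `IsReward.chordGap_lt`, `Market.lossGap_lt`). It gives uniqueness of the
tangency points, existence by the intermediate value theorem, and their order.

If `D` is strictly convex, the loss branch `-ν D(θ - x)` is concave and lies below its tangents; the
absence of a tangency pair is exploited through `exists_tangentPair_gt`, which compares the slopes
of the two branches. If `D` is concave, the loss branch is convex and lies below its chords, so only
the abscissas `0`, `L` and `θ` have to be tested (`Market.loss_le_line`). -/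

namespace RatioVaR

/-! ### Reward functions -/

/-- Mean value theorem between `x` and `b`. Only continuity is needed at `0`, so the end point,
where `U'` is infinite, is included. The lemma serves `U` and also `-D` for strictly convex `D`. -/
theorem lt_tangent_of_strictAntiOn_deriv {V : ℝ → ℝ} (hc : ContinuousOn V (Ici 0))
    (hd : DifferentiableOn ℝ V (Ioi 0)) (ha : StrictAntiOn (deriv V) (Ioi 0))
    {b x : ℝ} (hb : 0 < b) (hx : 0 ≤ x) (hxb : x ≠ b) :
    V x < V b + deriv V b * (x - b) := by
  rcases lt_or_gt_of_ne hxb with h | h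
  · obtain ⟨c, ⟨hc1, hc2⟩, hc3⟩ := exists_deriv_eq_slope V h
      (hc.mono fun y hy => le_trans hx hy.1) (hd.mono fun y hy => lt_of_le_of_lt hx hy.1)
    have h1 : deriv V b < deriv V c := ha (lt_of_le_of_lt hx hc1) hb hc2
    rw [eq_div_iff (by linarith)] at hc3
    nlinarith [mul_pos (sub_pos.2 h1) (sub_pos.2 h)]
  · obtain ⟨c, ⟨hc1, hc2⟩, hc3⟩ := exists_deriv_eq_slope V h
      (hc.mono fun y hy => le_trans hb.le hy.1) (hd.mono fun y hy => lt_trans hb hy.1)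
    have h1 : deriv V c < deriv V b := ha hb (lt_trans hb hc1) hc1
    rw [eq_div_iff (by linarith)] at hc3
    nlinarith [mul_pos (sub_pos.2 h1) (sub_pos.2 h)]

namespace IsReward

variable {U : ℝ → ℝ}

theorem deriv_continuousOn (hU : IsReward U) : ContinuousOn (deriv U) (Ioi 0) :=
  hU.differentiableOn_deriv.continuousOn

theorem deriv_strictAntiOn (hU : IsReward U) : StrictAntiOn (deriv U) (Ioi 0) :=
  strictAntiOn_of_deriv_neg (convex_Ioi 0) hU.deriv_continuousOn
    fun x hx => hU.deriv2_neg x (by simpa using hx)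

theorem deriv_le_iff (hU : IsReward U) {x y : ℝ} (hx : 0 < x) (hy : 0 < y) :
    deriv U x ≤ deriv U y ↔ y ≤ x :=
  hU.deriv_strictAntiOn.le_iff_ge hx hy

theorem deriv_lt_iff (hU : IsReward U) {x y : ℝ} (hx : 0 < x) (hy : 0 < y) :
    deriv U x < deriv U y ↔ y < x :=
  hU.deriv_strictAntiOn.lt_iff_gt hx hy

theorem deriv_pos (hU : IsReward U) {x : ℝ} (hx : 0 < x) : 0 < deriv U x := by
  have h1 : 0 ≤ deriv U (x + 1) := by
    refine le_of_tendsto hU.inada_top ?_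
    filter_upwards [eventually_ge_atTop (x + 1)] with y hy
    exact (hU.deriv_le_iff (lt_of_lt_of_le (by linarith) hy) (by linarith)).2 hy
  exact lt_of_le_of_lt h1 ((hU.deriv_lt_iff (by linarith) hx).2 (by linarith))

theorem lt_tangent (hU : IsReward U) {b x : ℝ} (hb : 0 < b) (hx : 0 ≤ x) (hxb : x ≠ b) :
    U x < U b + deriv U b * (x - b) :=
  lt_tangent_of_strictAntiOn_deriv hU.continuousOn hU.differentiableOn hU.deriv_strictAntiOn
    hb hx hxb

theorem le_tangent (hU : IsReward U) {b x : ℝ} (hb : 0 < b) (hx : 0 ≤ x) :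
    U x ≤ U b + deriv U b * (x - b) := by
  rcases eq_or_ne x b with rfl | h
  · simp
  · exact (hU.lt_tangent hb hx h).le

theorem exists_deriv_gt (hU : IsReward U) {b : ℝ} (hb : 0 < b) (y : ℝ) :
    ∃ x, 0 < x ∧ x < b ∧ y < deriv U x := by
  have h1 := (hU.inada_zero.eventually_gt_atTop y).and (Ioo_mem_nhdsGT hb)
  obtain ⟨x, h2, h3⟩ := h1.exists
  exact ⟨x, h3.1, h3.2, h2⟩

theorem exists_deriv_lt (hU : IsReward U) (b : ℝ) {y : ℝ} (hy : 0 < y) :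
    ∃ x, b < x ∧ deriv U x < y :=
  ((eventually_gt_atTop b).and (hU.inada_top.eventually_lt_const hy)).exists

theorem exists_deriv_eq (hU : IsReward U) {y : ℝ} (hy : 0 < y) : ∃ x, 0 < x ∧ deriv U x = y := by
  obtain ⟨a, ha, -, hay⟩ := hU.exists_deriv_gt one_pos y
  obtain ⟨b, hab, hby⟩ := hU.exists_deriv_lt a hy
  obtain ⟨x, hx, hxy⟩ := intermediate_value_Icc' hab.le
    (hU.deriv_continuousOn.mono fun t ht => lt_of_lt_of_le ha ht.1) ⟨hby.le, hay.le⟩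
  exact ⟨x, lt_of_lt_of_le ha hx.1, hxy⟩

theorem derivInv_deriv (hU : IsReward U) {x : ℝ} (hx : 0 < x) : derivInv U (deriv U x) = x :=
  hU.deriv_strictAntiOn.injOn.leftInvOn_invFunOn hx

theorem derivInv_pos (hU : IsReward U) {y : ℝ} (hy : 0 < y) : 0 < derivInv U y := by
  obtain ⟨x, hx, rfl⟩ := hU.exists_deriv_eq hy
  rwa [hU.derivInv_deriv hx]

theorem deriv_derivInv (hU : IsReward U) {y : ℝ} (hy : 0 < y) : deriv U (derivInv U y) = y := by
  obtain ⟨x, hx, rfl⟩ := hU.exists_deriv_eq hy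
  rw [hU.derivInv_deriv hx]

theorem derivInv_continuousOn (hU : IsReward U) : ContinuousOn (derivInv U) (Ioi 0) := by
  intro y hy
  -- The negated inverse is monotone with open image `(-∞, 0)`, which forces continuity.
  have hm : MonotoneOn (fun t => -derivInv U t) (Ioi 0) := by
    intro s hs t ht hst
    rw [← hU.deriv_derivInv hs, ← hU.deriv_derivInv ht,
      hU.deriv_le_iff (hU.derivInv_pos hs) (hU.derivInv_pos ht)] at hst
    exact neg_le_neg hst
  have hi : (fun t => -derivInv U t) '' Ioi 0 = Iio 0 := by
    ext t
    constructor
    · rintro ⟨s, hs, rfl⟩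
      exact neg_lt_zero.2 (hU.derivInv_pos hs)
    · intro ht
      have ht' : 0 < -t := neg_pos.2 ht
      exact ⟨deriv U (-t), hU.deriv_pos ht', by simp [hU.derivInv_deriv ht']⟩
  have h := continuousAt_of_monotoneOn_of_image_mem_nhds hm (Ioi_mem_nhds hy)
    (by rw [hi]; exact Iio_mem_nhds (neg_lt_zero.2 (hU.derivInv_pos hy)))
  have h' := h.neg
  rw [show -(fun t => -derivInv U t) = derivInv U by ext; simp] at h'
  exact h'.continuousWithinAt

/-- `U x + c - (x + r) U' x` is strictly increasing. -/
theorem tangentGap_lt (hU : IsReward U) {r x y : ℝ} (hr : 0 ≤ r) (hx : 0 < x) (hxy : x < y) :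
    U x - (x + r) * deriv U x < U y - (y + r) * deriv U y := by
  have h1 := hU.lt_tangent (hx.trans hxy) hx.le hxy.ne
  have h2 := (hU.deriv_lt_iff (hx.trans hxy) hx).2 hxy
  nlinarith [mul_nonneg (add_nonneg hx.le hr) (sub_pos.2 h2).le]

theorem tangentGap_pos (hU : IsReward U) {x : ℝ} (hx : 0 < x) : 0 < U x - x * deriv U x := by
  have := hU.lt_tangent hx le_rfl hx.ne
  rw [hU.map_zero] at this
  linarith

theorem exists_tangentGap_eq_zero (hU : IsReward U) {r c : ℝ} (hr : 0 < r) (hc : 0 ≤ c) :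
    ∃ x, 0 < x ∧ U x + c - (x + r) * deriv U x = 0 := by
  -- At `a < 1` the term `r U'(a)` exceeds `U 1 + c`, so the gap is negative. At `b` below, `r
  -- U'(b)` is smaller than `U 1 - U'(1)`, a lower bound for the gap with `r = c = 0`, so the gap is
  -- positive.
  obtain ⟨a, ha, ha1, h1⟩ := hU.exists_deriv_gt one_pos ((U 1 + c) / r)
  have e0 : 0 < U 1 - 1 * deriv U 1 := hU.tangentGap_pos one_pos
  obtain ⟨b, hb, h2⟩ := hU.exists_deriv_lt 1 (div_pos e0 hr)
  rw [div_lt_iff₀ hr] at h1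
  rw [lt_div_iff₀ hr] at h2
  have h3 := hU.strictMonoOn (mem_Ici.2 ha.le) (mem_Ici.2 zero_le_one) ha1
  have h4 := mul_pos ha (hU.deriv_pos ha)
  have h5 := hU.tangentGap_lt le_rfl one_pos hb
  have hcont : ContinuousOn (fun x => U x + c - (x + r) * deriv U x) (Icc a b) := by
    have hs : ∀ t ∈ Icc a b, 0 < t := fun t ht => lt_of_lt_of_le ha ht.1
    exact ((hU.continuousOn.mono fun t ht => (hs t ht).le).add continuousOn_const).sub
      ((continuousOn_id.add continuousOn_const).mul (hU.deriv_continuousOn.mono hs))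
  obtain ⟨x, hx, hx0⟩ := intermediate_value_Icc (ha1.trans hb).le hcont
    (show (0 : ℝ) ∈ Icc _ _ from ⟨by nlinarith, by nlinarith⟩)
  exact ⟨x, lt_of_lt_of_le ha hx.1, hx0⟩

/-- The height at `M` of the tangent at `x` sinks as `x` moves right towards `M`. This governs
tangents drawn from the jump point to the gain branch on its left. -/
theorem chordGap_lt (hU : IsReward U) {M x y : ℝ} (hx : 0 < x) (hxy : x < y) (hy : y ≤ M) :
    U y + (M - y) * deriv U y < U x + (M - x) * deriv U x := by
  have h1 := hU.lt_tangent hx (hx.trans hxy).le hxy.ne'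
  have h2 := (hU.deriv_lt_iff (hx.trans hxy) hx).2 hxy
  nlinarith [mul_nonneg (sub_nonneg.2 hy) (sub_pos.2 h2).le]

theorem exists_chordGap_eq (hU : IsReward U) {M a t : ℝ} (ha : 0 < a) (haM : a ≤ M)
    (h1 : U M ≤ t) (h2 : t ≤ U a + (M - a) * deriv U a) :
    ∃ x, a ≤ x ∧ x ≤ M ∧ U x + (M - x) * deriv U x = t := by
  have hcont : ContinuousOn (fun x => U x + (M - x) * deriv U x) (Icc a M) := by
    have hs : ∀ t ∈ Icc a M, 0 < t := fun t ht => lt_of_lt_of_le ha ht.1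
    exact (hU.continuousOn.mono fun t ht => (hs t ht).le).add
      ((continuousOn_const.sub continuousOn_id).mul (hU.deriv_continuousOn.mono hs))
  obtain ⟨x, hx, hx0⟩ := intermediate_value_Icc' haM hcont
    (show t ∈ Icc _ _ from ⟨by simpa using h1, h2⟩)
  exact ⟨x, hx.1, hx.2, hx0⟩

end IsReward

/-! ### Penalty functions -/

namespace IsPenalty

variable {D : ℝ → ℝ}

theorem deriv_continuousOn (hD : IsPenalty D) : ContinuousOn (deriv D) (Ioi 0) :=
  hD.differentiableOn_deriv.continuousOn

theorem nonneg (hD : IsPenalty D) {x : ℝ} (hx : 0 ≤ x) : 0 ≤ D x := by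
  have := hD.strictMonoOn.monotoneOn self_mem_Ici hx hx
  rwa [hD.map_zero] at this

theorem deriv_strictMonoOn (hD : IsPenalty D) (hc : StrictConvexOn ℝ (Ici 0) D) :
    StrictMonoOn (deriv D) (Ioi 0) :=
  (hc.subset Ioi_subset_Ici_self (convex_Ioi 0)).strictMonoOn_deriv
    fun x hx => (hD.differentiableOn x hx).differentiableAt (Ioi_mem_nhds hx)

theorem deriv_nonneg (hD : IsPenalty D) {x : ℝ} (hx : 0 < x) : 0 ≤ deriv D x := by
  have h := (hD.strictMonoOn.monotoneOn.mono Ioi_subset_Ici_self).derivWithin_nonneg (x := x)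
  rwa [derivWithin_of_isOpen isOpen_Ioi hx] at h

theorem deriv_pos (hD : IsPenalty D) (hc : StrictConvexOn ℝ (Ici 0) D) {x : ℝ} (hx : 0 < x) :
    0 < deriv D x :=
  lt_of_le_of_lt (hD.deriv_nonneg (half_pos hx))
    (hD.deriv_strictMonoOn hc (half_pos hx) hx (half_lt_self hx))

theorem tangent_lt (hD : IsPenalty D) (hc : StrictConvexOn ℝ (Ici 0) D) {b x : ℝ} (hb : 0 < b)
    (hx : 0 ≤ x) (hxb : x ≠ b) : D b + deriv D b * (x - b) < D x := by
  have h := lt_tangent_of_strictAntiOn_deriv (V := -D) hD.continuousOn.neg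
    hD.differentiableOn.neg
    (fun s hs t ht hst => by
      simpa [deriv.neg] using hD.deriv_strictMonoOn hc hs ht hst) hb hx hxb
  simp only [deriv.neg, Pi.neg_apply] at h
  linarith

theorem tangent_le (hD : IsPenalty D) (hc : StrictConvexOn ℝ (Ici 0) D) {b x : ℝ} (hb : 0 < b)
    (hx : 0 ≤ x) : D b + deriv D b * (x - b) ≤ D x := by
  rcases eq_or_ne x b with rfl | h
  · simp
  · exact (hD.tangent_lt hc hb hx h).le

theorem derivInv_deriv (hD : IsPenalty D) (hc : StrictConvexOn ℝ (Ici 0) D) {x : ℝ} (hx : 0 < x) :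
    derivInv D (deriv D x) = x :=
  (hD.deriv_strictMonoOn hc).injOn.leftInvOn_invFunOn hx

end IsPenalty

/-- With denominators cleared, the chord inequality remains valid for `a = b` and is ready for
linear arithmetic. -/
theorem chord_le_of_concaveOn {D : ℝ → ℝ} (hc : ConcaveOn ℝ (Ici 0) D) {a b x : ℝ} (ha : 0 ≤ a)
    (hx : a ≤ x) (hxb : x ≤ b) : (b - x) * D a + (x - a) * D b ≤ (b - a) * D x := by
  rcases (hx.trans hxb).eq_or_lt with rfl | hab
  · obtain rfl : x = a := le_antisymm hxb hx
    simp
  have hba : 0 < b - a := sub_pos.2 hab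
  have h := hc.2 (mem_Ici.2 ha) (mem_Ici.2 (ha.trans hab.le))
    (div_nonneg (sub_nonneg.2 hxb) hba.le) (div_nonneg (sub_nonneg.2 hx) hba.le)
    (by field_simp; ring)
  have e : (b - x) / (b - a) * a + (x - a) / (b - a) * b = x := by field_simp; ring
  simp only [smul_eq_mul, e] at h
  have h' := mul_le_mul_of_nonneg_left h hba.le
  have e' : (b - a) * ((b - x) / (b - a) * D a + (x - a) / (b - a) * D b)
    = (b - x) * D a + (x - a) * D b := by field_simp
  linarith

/-! ### Supporting lines and the assembly of solutions -/

/-- The line of slope `s` through `(p, f p)` lies above `f` on `[0, ∞)`. -/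
def Dominates (f : ℝ → ℝ) (s p : ℝ) : Prop :=
  0 ≤ p ∧ ∀ x, 0 ≤ x → f x ≤ f p + s * (x - p)

/-- The line of slope `s` through `(p, f p)` lies strictly above `f` on `[0, ∞)`, except at `p`. -/
def StrictlyDominates (f : ℝ → ℝ) (s p : ℝ) : Prop :=
  0 ≤ p ∧ ∀ x, 0 ≤ x → x ≠ p → f x < f p + s * (x - p)

/-- The part on `[c, ∞)` of the property `IsSolution`. -/
def SolvesFrom (f : ℝ → ℝ) (c : ℝ) (pieces : List ((ℝ → ℝ) × ℝ)) : Prop :=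
  (∀ p ∈ pieces, c ≤ p.2) ∧
  pieces.Pairwise (fun p q => p.2 ≤ q.2) ∧
  ∀ y, c ≤ y → Dominates f y (piecewiseFn pieces y) ∧
    (c ≠ y → (∀ p ∈ pieces, y ≠ p.2) → StrictlyDominates f y (piecewiseFn pieces y))

variable {f : ℝ → ℝ}

theorem StrictlyDominates.dominates {s p : ℝ} (h : StrictlyDominates f s p) : Dominates f s p := by
  refine ⟨h.1, fun x hx => ?_⟩
  rcases eq_or_ne x p with rfl | hxp
  · simp
  · exact (h.2 x hx hxp).le

namespace Dominates

variable {s t p q r y g : ℝ}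

/-- A line touching `f` twice supports it at both points; this hands the break slope over from one
piece to the next. -/
theorem of_touch (h : Dominates f s p) (hq : 0 ≤ q) (hpq : f q = f p + s * (q - p)) :
    Dominates f s q :=
  ⟨hq, fun x hx => by have := h.2 x hx; linarith⟩

/-- Beyond `q` the old line bounds `f`, and the steeper new line, being above it at `q`, stays above
it; only `[0, q]` is left to check. `flatter` is the mirror image. -/
theorem steeper (h : Dominates f s q) (hst : s ≤ t) (hr : 0 ≤ r)
    (hx : ∀ x, 0 ≤ x → x ≤ q → f x ≤ f r + t * (x - r)) : Dominates f t r := by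
  refine ⟨hr, fun x hx0 => ?_⟩
  rcases le_total x q with hxq | hxq
  · exact hx x hx0 hxq
  · have h1 := h.2 x hx0
    have h2 := hx q h.1 le_rfl
    nlinarith [mul_nonneg (sub_nonneg.2 hst) (sub_nonneg.2 hxq)]

theorem flatter (h : Dominates f s q) (hst : t ≤ s) (hqr : q ≤ r)
    (hx : ∀ x, q ≤ x → f x ≤ f r + t * (x - r)) : Dominates f t r := by
  refine ⟨h.1.trans hqr, fun x hx0 => ?_⟩
  rcases le_total q x with hxq | hxq
  · exact hx x hxq
  · have h1 := h.2 x hx0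
    have h2 := hx q le_rfl
    nlinarith [mul_nonneg (sub_nonneg.2 hst) (sub_nonneg.2 hxq)]

/-- Left of `p` the line of slope `t` bounds `f`, and the flatter line, not below it at `p`, is
strictly above it there. -/
theorem strictlyDominates_of_lt (hp : Dominates f t p) (hyt : y < t) (hpg : p ≤ g)
    (hx : ∀ x, p ≤ x → x ≠ g → f x < f g + y * (x - g)) : StrictlyDominates f y g := by
  refine ⟨hp.1.trans hpg, fun x hx0 hxg => ?_⟩
  rcases le_or_gt p x with hpx | hpx
  · exact hx x hpx hxg
  · have h1 := hp.2 x hx0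
    have h2 : f p ≤ f g + y * (p - g) := by
      rcases eq_or_ne p g with rfl | hne
      · simp
      · exact (hx p le_rfl hne).le
    nlinarith [mul_pos (sub_pos.2 hyt) (sub_pos.2 hpx)]

theorem strictlyDominates_of_mem (hq : Dominates f s q) (hp : Dominates f t p) (hsy : s < y)
    (hyt : y < t) (hpg : p ≤ g) (hgq : g ≤ q)
    (hx : ∀ x, p ≤ x → x ≤ q → x ≠ g → f x < f g + y * (x - g)) : StrictlyDominates f y g := by
  refine hp.strictlyDominates_of_lt hyt hpg fun x hpx hxg => ?_
  rcases le_or_gt x q with hxq | hxq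
  · exact hx x hpx hxq hxg
  · have h1 := hq.2 x (hp.1.trans hpx)
    have h2 : f q ≤ f g + y * (q - g) := by
      rcases eq_or_ne q g with rfl | hne
      · simp
      · exact (hx q (hpg.trans hgq) le_rfl hne).le
    nlinarith [mul_pos (sub_pos.2 hsy) (sub_pos.2 hxq)]

theorem solvesFrom_nil (h : Dominates f s 0) : SolvesFrom f s [] := by
  refine ⟨by simp, List.Pairwise.nil, fun y hy => ?_⟩
  have key : s ≠ y → StrictlyDominates f y 0 := fun hsy => by
    refine ⟨le_rfl, fun x hx hx0 => ?_⟩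
    have h1 := h.2 x hx
    have h2 : 0 < x := lt_of_le_of_ne hx hx0.symm
    nlinarith [mul_pos (sub_pos.2 (lt_of_le_of_ne hy hsy)) h2]
  simp only [piecewiseFn]
  refine ⟨?_, fun hsy _ => key hsy⟩
  rcases eq_or_ne s y with rfl | hsy
  · exact h
  · exact (key hsy).dominates

end Dominates

theorem SolvesFrom.cons {c b : ℝ} {g : ℝ → ℝ} {rest : List ((ℝ → ℝ) × ℝ)} (hcb : c ≤ b)
    (hc : Dominates f c (g c)) (hg : ∀ y, c < y → y < b → StrictlyDominates f y (g y))
    (h : SolvesFrom f b rest) : SolvesFrom f c ((g, b) :: rest) := by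
  refine ⟨?_, List.Pairwise.cons (fun p hp => h.1 p hp) h.2.1, fun y hy => ?_⟩
  · intro p hp
    rcases List.mem_cons.1 hp with rfl | hp
    · exact hcb
    · exact hcb.trans (h.1 p hp)
  · simp only [piecewiseFn]
    split_ifs with hyb
    · rcases hy.eq_or_lt with rfl | hcy
      · exact ⟨hc, fun h => absurd rfl h⟩
      · exact ⟨(hg y hcy hyb).dominates, fun _ _ => hg y hcy hyb⟩
    · have h3 := h.2.2 y (not_lt.1 hyb)
      refine ⟨h3.1, fun _ hne => h3.2 (hne (g, b) (by simp)).symm fun p hp => ?_⟩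
      exact hne p (List.mem_cons_of_mem _ hp)

theorem SolvesFrom.isSolution {b : ℝ} {g : ℝ → ℝ} {rest : List ((ℝ → ℝ) × ℝ)} (hb : 0 < b)
    (hg : ∀ y, 0 < y → y < b → StrictlyDominates f y (g y))
    (h : SolvesFrom f b rest) : IsSolution f ((g, b) :: rest) := by
  have key : ∀ y, 0 < y → Dominates f y (piecewiseFn ((g, b) :: rest) y) ∧
      ((∀ p ∈ (g, b) :: rest, y ≠ p.2) →
        StrictlyDominates f y (piecewiseFn ((g, b) :: rest) y)) := by
    intro y hy
    simp only [piecewiseFn]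
    split_ifs with hyb
    · exact ⟨(hg y hy hyb).dominates, fun _ => hg y hy hyb⟩
    · have h3 := h.2.2 y (not_lt.1 hyb)
      refine ⟨h3.1, fun hne => h3.2 (hne (g, b) (by simp)).symm fun p hp => ?_⟩
      exact hne p (List.mem_cons_of_mem _ hp)
  refine ⟨?_, List.Pairwise.cons (fun p hp => h.1 p hp) h.2.1, fun y hy => ?_⟩
  · intro p hp
    rcases List.mem_cons.1 hp with rfl | hp
    · exact hb
    · exact hb.trans_le (h.1 p hp)
  · obtain ⟨h1, h2⟩ := key y hy
    refine ⟨h1.1, fun x hx => by linarith [h1.2 x hx], fun hne x hx hxe => ?_⟩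
    by_contra hxp
    linarith [(h2 hne).2 x hx hxp]

theorem SolvesFrom.const_cons {c b l : ℝ} {rest : List ((ℝ → ℝ) × ℝ)} (hcb : c ≤ b)
    (hc : Dominates f c l) (hb : Dominates f b l) (h : SolvesFrom f b rest) :
    SolvesFrom f c ((fun _ => l, b) :: rest) :=
  h.cons hcb hc fun _ h1 h2 => hc.strictlyDominates_of_mem hb h1 h2 le_rfl le_rfl
    fun _ hx hx' hne => absurd (le_antisymm hx' hx) hne

/-! ### Tangent inequalities for the two branches in the variable `x`, and the pieces that follow a
branch. -/

section Shifted

variable {U D : ℝ → ℝ} {θ ν κ : ℝ}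

theorem IsReward.lt_tangent_shift (hU : IsReward U) {b x : ℝ} (hb : θ < b) (hx : θ ≤ x)
    (hxb : x ≠ b) : U (x - θ) < U (b - θ) + deriv U (b - θ) * (x - b) := by
  have := hU.lt_tangent (sub_pos.2 hb) (sub_nonneg.2 hx) (by simpa using hxb)
  linarith

theorem IsReward.le_tangent_shift (hU : IsReward U) {b x : ℝ} (hb : θ < b) (hx : θ ≤ x) :
    U (x - θ) ≤ U (b - θ) + deriv U (b - θ) * (x - b) := by
  have := hU.le_tangent (sub_pos.2 hb) (sub_nonneg.2 hx)
  linarith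

theorem IsReward.deriv_shift_le_iff (hU : IsReward U) {a b : ℝ} (ha : θ < a) (hb : θ < b) :
    deriv U (a - θ) ≤ deriv U (b - θ) ↔ b ≤ a := by
  rw [hU.deriv_le_iff (sub_pos.2 ha) (sub_pos.2 hb), sub_le_sub_iff_right]

theorem IsReward.deriv_shift_lt_iff (hU : IsReward U) {a b : ℝ} (ha : θ < a) (hb : θ < b) :
    deriv U (a - θ) < deriv U (b - θ) ↔ b < a := by
  rw [hU.deriv_lt_iff (sub_pos.2 ha) (sub_pos.2 hb), sub_lt_sub_iff_right]

theorem IsPenalty.neg_lt_tangent_shift (hD : IsPenalty D) (hc : StrictConvexOn ℝ (Ici 0) D)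
    (hν : 0 < ν) {a x : ℝ} (ha : a < θ) (hx : x ≤ θ) (hxa : x ≠ a) :
    -(ν * D (θ - x)) < -(ν * D (θ - a)) + ν * deriv D (θ - a) * (x - a) := by
  have := hD.tangent_lt hc (sub_pos.2 ha) (sub_nonneg.2 hx) (by simpa using hxa)
  nlinarith [mul_lt_mul_of_pos_left this hν]

theorem IsPenalty.neg_le_tangent_shift (hD : IsPenalty D) (hc : StrictConvexOn ℝ (Ici 0) D)
    (hν : 0 ≤ ν) {a x : ℝ} (ha : a < θ) (hx : x ≤ θ) :
    -(ν * D (θ - x)) ≤ -(ν * D (θ - a)) + ν * deriv D (θ - a) * (x - a) := by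
  have := hD.tangent_le hc (sub_pos.2 ha) (sub_nonneg.2 hx)
  nlinarith [mul_le_mul_of_nonneg_left this hν]

theorem IsPenalty.deriv_shift_le (hD : IsPenalty D) (hc : StrictConvexOn ℝ (Ici 0) D)
    (hν : 0 ≤ ν) {a b : ℝ} (hab : a ≤ b) (hb : b < θ) :
    ν * deriv D (θ - b) ≤ ν * deriv D (θ - a) :=
  mul_le_mul_of_nonneg_left ((hD.deriv_strictMonoOn hc).monotoneOn
    (mem_Ioi.2 (by linarith)) (mem_Ioi.2 (by linarith)) (by linarith)) hν

theorem IsPenalty.deriv_shift_lt (hD : IsPenalty D) (hc : StrictConvexOn ℝ (Ici 0) D)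
    (hν : 0 < ν) {a b : ℝ} (hab : a < b) (hb : b < θ) :
    ν * deriv D (θ - b) < ν * deriv D (θ - a) :=
  mul_lt_mul_of_pos_left (hD.deriv_strictMonoOn hc
    (mem_Ioi.2 (by linarith)) (mem_Ioi.2 (by linarith)) (by linarith)) hν

theorem gainPiece_deriv (hU : IsReward U) {x : ℝ} (hx : θ < x) :
    gainPiece U θ (deriv U (x - θ)) = x := by
  rw [gainPiece, hU.derivInv_deriv (sub_pos.2 hx), sub_add_cancel]

theorem lossPiece_deriv (hD : IsPenalty D) (hc : StrictConvexOn ℝ (Ici 0) D) (hν : 0 < ν) {x : ℝ}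
    (hx : x < θ) : lossPiece D θ ν (ν * deriv D (θ - x)) = x := by
  rw [lossPiece, mul_div_cancel_left₀ _ hν.ne', hD.derivInv_deriv hc (sub_pos.2 hx), sub_sub_cancel]

/-- The first piece of every solution: slopes below `U'(p - θ)` touch the gain branch to the right
of `p`, so the supporting line at `p` deals with everything on the left. The constant `κ` absorbs
the bonus `λ`. -/
theorem isSolution_gain_cons (hU : IsReward U) {p : ℝ} {rest : List ((ℝ → ℝ) × ℝ)} (hp : θ < p)
    (hf : ∀ x, p ≤ x → f x = U (x - θ) + κ) (hdom : Dominates f (deriv U (p - θ)) p)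
    (h : SolvesFrom f (deriv U (p - θ)) rest) :
    IsSolution f ((gainPiece U θ, deriv U (p - θ)) :: rest) := by
  refine h.isSolution (hU.deriv_pos (sub_pos.2 hp)) fun y hy hyp => ?_
  obtain ⟨g, hg, rfl⟩ := hU.exists_deriv_eq hy
  rw [hU.deriv_lt_iff hg (sub_pos.2 hp)] at hyp
  have hg' : gainPiece U θ (deriv U g) = g + θ := by rw [gainPiece, hU.derivInv_deriv hg]
  rw [hg']
  have hpg : p ≤ g + θ := by linarith
  refine hdom.strictlyDominates_of_lt ((hU.deriv_lt_iff hg (sub_pos.2 hp)).2 hyp) hpg ?_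
  intro x hpx hx
  rw [hf x hpx, hf _ hpg, add_sub_cancel_right]
  have := hU.lt_tangent hg (sub_nonneg.2 (hp.le.trans hpx)) (fun h => hx (by linarith))
  linarith

theorem SolvesFrom.gain_cons (hU : IsReward U) {p q : ℝ} {rest : List ((ℝ → ℝ) × ℝ)} (hp : θ < p)
    (hpq : p ≤ q) (hf : ∀ x, p ≤ x → x ≤ q → f x = U (x - θ) + κ)
    (hq : Dominates f (deriv U (q - θ)) q) (hdom : Dominates f (deriv U (p - θ)) p)
    (h : SolvesFrom f (deriv U (p - θ)) rest) :
    SolvesFrom f (deriv U (q - θ)) ((gainPiece U θ, deriv U (p - θ)) :: rest) := by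
  have hθq : θ < q := hp.trans_le hpq
  refine h.cons ((hU.deriv_shift_le_iff hθq hp).2 hpq) (by rwa [gainPiece_deriv hU hθq]) ?_
  intro y hqy hyp
  obtain ⟨g, hg, rfl⟩ := hU.exists_deriv_eq ((hU.deriv_pos (sub_pos.2 hθq)).trans hqy)
  have hg' : gainPiece U θ (deriv U g) = g + θ := by rw [gainPiece, hU.derivInv_deriv hg]
  have h1 := (hU.deriv_lt_iff (sub_pos.2 hθq) hg).1 hqy
  have h2 := (hU.deriv_lt_iff hg (sub_pos.2 hp)).1 hyp
  rw [hg']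
  have hpg : p ≤ g + θ := by linarith
  have hgq : g + θ ≤ q := by linarith
  refine hq.strictlyDominates_of_mem hdom hqy hyp hpg hgq ?_
  intro x hpx hxq hx
  rw [hf x hpx hxq, hf _ hpg hgq, add_sub_cancel_right]
  have := hU.lt_tangent hg (sub_nonneg.2 (hp.le.trans hpx)) (fun h => hx (by linarith))
  linarith

theorem SolvesFrom.loss_cons (hD : IsPenalty D) (hc : StrictConvexOn ℝ (Ici 0) D) (hν : 0 < ν)
    {p q : ℝ} {rest : List ((ℝ → ℝ) × ℝ)} (hpq : p ≤ q) (hqθ : q < θ)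
    (hf : ∀ x, p ≤ x → x ≤ q → f x = -(ν * D (θ - x)) + κ)
    (hq : Dominates f (ν * deriv D (θ - q)) q) (hdom : Dominates f (ν * deriv D (θ - p)) p)
    (h : SolvesFrom f (ν * deriv D (θ - p)) rest) :
    SolvesFrom f (ν * deriv D (θ - q)) ((lossPiece D θ ν, ν * deriv D (θ - p)) :: rest) := by
  refine h.cons (hD.deriv_shift_le hc hν.le hpq hqθ) (by rwa [lossPiece_deriv hD hc hν hqθ]) ?_
  intro y hqy hyp
  -- Unlike `U'`, the function `D'` need not attain every positive value; the contact point comes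
  -- from the intermediate value theorem between the slopes at `p` and `q`.
  have hcont : ContinuousOn (fun x => ν * deriv D (θ - x)) (Icc p q) :=
    continuousOn_const.mul (hD.deriv_continuousOn.comp (continuousOn_const.sub continuousOn_id)
      fun t ht => mem_Ioi.2 (sub_pos.2 (ht.2.trans_lt hqθ)))
  obtain ⟨g, ⟨hpg, hgq⟩, rfl⟩ := intermediate_value_Icc' hpq hcont ⟨hqy.le, hyp.le⟩
  have hgθ := hgq.trans_lt hqθ
  simp only [lossPiece_deriv hD hc hν hgθ]
  refine hq.strictlyDominates_of_mem hdom hqy hyp hpg hgq fun x hpx hxq hx => ?_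
  rw [hf x hpx hxq, hf g hpg hgq]
  linarith [hD.neg_lt_tangent_shift hc hν hgθ (hxq.trans hqθ.le) hx]

end Shifted

/-! ### Tangency points -/

section Tangency

variable {U D : ℝ → ℝ} {θ ν μ : ℝ}

/-- The two sides are the heights at `m` of the tangents to the gain branch at `x` and `y`. Read
backwards, in the next two lemmas, comparing heights at `m` orders the contact points. -/
theorem IsReward.tangentGap_shift_lt (hU : IsReward U) {m x y : ℝ} (hm : m ≤ θ) (hx : θ < x)
    (hxy : x < y) : U (x - θ) - deriv U (x - θ) * (x - m) < U (y - θ) - deriv U (y - θ) * (y - m) := by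
  have h := hU.tangentGap_lt (sub_nonneg.2 hm) (sub_pos.2 hx) (sub_lt_sub_right hxy θ)
  linarith

theorem IsReward.le_of_tangentGap_le (hU : IsReward U) {m x y : ℝ} (hm : m ≤ θ) (hy : θ < y)
    (h : U (x - θ) - deriv U (x - θ) * (x - m) ≤ U (y - θ) - deriv U (y - θ) * (y - m)) :
    x ≤ y := by
  by_contra hlt
  exact absurd (hU.tangentGap_shift_lt hm hy (not_le.1 hlt)) (not_lt.2 h)

theorem IsReward.lt_of_tangentGap_lt (hU : IsReward U) {m x y : ℝ} (hm : m ≤ θ) (hy : θ < y)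
    (h : U (x - θ) - deriv U (x - θ) * (x - m) < U (y - θ) - deriv U (y - θ) * (y - m)) :
    x < y := by
  refine lt_of_le_of_ne (hU.le_of_tangentGap_le hm hy h.le) ?_
  rintro rfl
  exact lt_irrefl _ h

/-- The tangent to the gain branch from the point `(m, -c)`; used with `m = 0` for the origin and
with `m = L` for a level below the threshold. -/
theorem IsReward.existsUnique_tangent (hU : IsReward U) {m c : ℝ} (hm : m < θ) (hc : 0 ≤ c) :
    ∃! z, θ < z ∧ deriv U (z - θ) * (z - m) = U (z - θ) + c := by
  obtain ⟨x, hx, hx0⟩ := hU.exists_tangentGap_eq_zero (sub_pos.2 hm) hc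
  refine ⟨x + θ, ⟨by linarith, by rw [add_sub_cancel_right]; linarith⟩, ?_⟩
  rintro y ⟨hy, hy0⟩
  have hx' : θ < x + θ := by linarith
  apply le_antisymm
  · refine hU.le_of_tangentGap_le hm.le hx' ?_
    rw [add_sub_cancel_right]; linarith
  · refine hU.le_of_tangentGap_le hm.le hy ?_
    rw [add_sub_cancel_right]; linarith

theorem tangentZero_iff (hθ : 0 < θ) {z : ℝ} :
    TangentZero U D θ ν μ z ↔
      θ < z ∧ deriv U (z - θ) * (z - 0) = U (z - θ) + (μ + ν * D θ) := by
  refine and_congr_right fun hz => ?_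
  rw [eq_div_iff (hθ.trans hz).ne', sub_zero, add_assoc]

theorem TangentZero.mul_eq (hθ : 0 < θ) {z : ℝ} (h : TangentZero U D θ ν μ z) :
    deriv U (z - θ) * z = U (z - θ) + μ + ν * D θ := by
  have := ((tangentZero_iff hθ).1 h).2
  linarith

theorem TangentPair.mul_eq {a b : ℝ} (h : TangentPair U D θ ν μ a b) :
    deriv U (b - θ) * (b - a) = U (b - θ) + μ + ν * D (θ - a) := by
  have h1 := h.2.2.2
  rw [eq_div_iff (by linarith [h.1, h.2.1])] at h1
  linarith

theorem TangentPair.nu_pos (hU : IsReward U) (hν : 0 ≤ ν) {a b : ℝ}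
    (h : TangentPair U D θ ν μ a b) : 0 < ν := by
  refine lt_of_le_of_ne hν ?_
  rintro rfl
  have := hU.deriv_pos (sub_pos.2 h.2.1)
  rw [← h.2.2.1, zero_mul] at this
  exact lt_irrefl _ this

/-- If `a < a'`, the line of the first pair is strictly above that of the second at `a'` and is
steeper, hence strictly above it at `b`. But there it meets the raised gain branch, which lies below
the second line. -/
theorem TangentPair.fst_le (hU : IsReward U) (hD : IsPenalty D) (hc : StrictConvexOn ℝ (Ici 0) D)
    (hν : 0 ≤ ν) {a b a' b' : ℝ} (h : TangentPair U D θ ν μ a b)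
    (h' : TangentPair U D θ ν μ a' b') : a' ≤ a := by
  by_contra hlt
  have hlt := not_le.1 hlt
  have hν := h.nu_pos hU hν
  have e := h.mul_eq
  have e' := h'.mul_eq
  obtain ⟨ha, hb, hs, -⟩ := h
  obtain ⟨ha', hb', hs', -⟩ := h'
  have h1 := hD.neg_lt_tangent_shift hc hν ha ha'.le hlt.ne'
  have h2 := hU.le_tangent_shift hb' hb.le
  have h3 := hD.deriv_shift_lt hc hν hlt ha'
  rw [hs] at h1 h3
  rw [hs'] at h3
  nlinarith [mul_pos (sub_pos.2 h3) (show 0 < b - a' by linarith)]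

theorem TangentPair.unique (hU : IsReward U) (hD : IsPenalty D) (hc : StrictConvexOn ℝ (Ici 0) D)
    (hν : 0 ≤ ν) {a b a' b' : ℝ} (h : TangentPair U D θ ν μ a b)
    (h' : TangentPair U D θ ν μ a' b') : a = a' ∧ b = b' := by
  obtain rfl : a = a' := le_antisymm (h'.fst_le hU hD hc hν h) (h.fst_le hU hD hc hν h')
  refine ⟨rfl, ?_⟩
  have h1 := hU.deriv_strictAntiOn.injOn (sub_pos.2 h.2.1) (sub_pos.2 h'.2.1)
    (h.2.2.1.symm.trans h'.2.2.1)
  linarith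

/-- If the tangent to the gain branch that is parallel to the tangent at `a₀` to the loss branch
lies below it, then there is a tangency pair to the right of `a₀`. -/
theorem exists_tangentPair_gt (hU : IsReward U) (hD : IsPenalty D)
    (hc : StrictConvexOn ℝ (Ici 0) D) (hν : 0 < ν) (hμ : 0 ≤ μ) {a₀ b₀ : ℝ} (ha₀ : a₀ < θ)
    (hb₀ : θ < b₀) (hs : ν * deriv D (θ - a₀) = deriv U (b₀ - θ))
    (hlt : U (b₀ - θ) + μ + ν * D (θ - a₀) < deriv U (b₀ - θ) * (b₀ - a₀)) :
    ∃ a b, TangentPair U D θ ν μ a b ∧ a₀ < a := by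
  have hδ : ∀ a, a < θ → 0 < ν * deriv D (θ - a) := fun a ha =>
    mul_pos hν (hD.deriv_pos hc (sub_pos.2 ha))
  have he := hU.tangentGap_pos (sub_pos.2 hb₀)
  -- `e` is the height at `θ` of the tangent at `b₀`. The distance `t` is chosen so small that a
  -- line of slope at most `ν D'(θ - a₀)` loses no more than `e` on `[θ - t, θ]`.
  obtain ⟨e, he0⟩ : ∃ e, e = U (b₀ - θ) - (b₀ - θ) * deriv U (b₀ - θ) := ⟨_, rfl⟩
  rw [← he0] at he
  obtain ⟨t, ht⟩ : ∃ t, t = min ((θ - a₀) / 2) (e / (ν * deriv D (θ - a₀))) := ⟨_, rfl⟩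
  have ht0 : 0 < t := by
    rw [ht]; exact lt_min (by linarith) (div_pos he (hδ a₀ ha₀))
  have ht1 : t ≤ (θ - a₀) / 2 := ht ▸ min_le_left _ _
  have ht2 : ν * deriv D (θ - a₀) * t ≤ e := by
    have : t ≤ e / (ν * deriv D (θ - a₀)) := ht ▸ min_le_right _ _
    rw [le_div_iff₀ (hδ a₀ ha₀)] at this
    linarith
  have hlt1 : a₀ < θ - t := by linarith
  have hcδ : ContinuousOn (fun a => ν * deriv D (θ - a)) (Icc a₀ (θ - t)) :=
    continuousOn_const.mul (hD.deriv_continuousOn.comp (continuousOn_const.sub continuousOn_id)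
      fun s hs => mem_Ioi.2 (by have := hs.2; linarith))
  have hcI : ContinuousOn (fun a => derivInv U (ν * deriv D (θ - a))) (Icc a₀ (θ - t)) :=
    hU.derivInv_continuousOn.comp hcδ fun s hs => hδ s (by have := hs.2; linarith)
  -- The function is the height at `a` of the raised gain tangent parallel to the loss tangent at
  -- `a`, measured from the loss branch. It is negative at `a₀`, positive at `θ - t`, and vanishes
  -- exactly at a tangency pair.
  have hcΦ : ContinuousOn (fun a => U (derivInv U (ν * deriv D (θ - a))) + μ + ν * D (θ - a) -
      ν * deriv D (θ - a) * (derivInv U (ν * deriv D (θ - a)) + (θ - a))) (Icc a₀ (θ - t)) := by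
    refine ContinuousOn.sub ((ContinuousOn.add ?_ continuousOn_const).add ?_) (hcδ.mul ?_)
    · exact hU.continuousOn.comp hcI fun s hs =>
        (hU.derivInv_pos (hδ s (by have := hs.2; linarith))).le
    · exact continuousOn_const.mul (hD.continuousOn.comp (continuousOn_const.sub continuousOn_id)
        fun s hs => mem_Ici.2 (by have := hs.2; linarith))
    · exact hcI.add (continuousOn_const.sub continuousOn_id)
  obtain ⟨a, ⟨ha1, ha2⟩, ha0⟩ := intermediate_value_Icc hlt1.le hcΦ
    (show (0 : ℝ) ∈ Icc _ _ from by
      constructor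
      · simp only [hs, hU.derivInv_deriv (sub_pos.2 hb₀)]
        linarith
      · have h1 : θ - t < θ := by linarith
        have h2 := hU.deriv_derivInv (hδ _ h1)
        have h3 := hU.derivInv_pos (hδ _ h1)
        have h4 := hD.deriv_shift_lt hc hν hlt1 h1
        have h5 := mul_nonneg hν.le (hD.nonneg (show 0 ≤ θ - (θ - t) by linarith))
        have h6 : b₀ - θ < derivInv U (ν * deriv D (θ - (θ - t))) := by
          rwa [← h2, hs, hU.deriv_lt_iff h3 (sub_pos.2 hb₀)] at h4
        have h7 := hU.tangentGap_lt le_rfl (sub_pos.2 hb₀) h6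
        rw [h2] at h7
        nlinarith [mul_lt_mul_of_pos_right h4 ht0])
  have haθ : a < θ := by linarith
  have h2 := hU.deriv_derivInv (hδ a haθ)
  have h3 := hU.derivInv_pos (hδ a haθ)
  simp only at ha0
  refine ⟨a, derivInv U (ν * deriv D (θ - a)) + θ, ⟨haθ, by linarith, ?_, ?_⟩, ?_⟩
  · rw [add_sub_cancel_right, h2]
  · rw [add_sub_cancel_right, h2, eq_div_iff (by linarith)]
    linarith
  · refine lt_of_le_of_ne ha1 ?_
    rintro rfl
    rw [hs, hU.derivInv_deriv (sub_pos.2 hb₀)] at ha0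
    linarith

theorem exists_tangentPair (hU : IsReward U) (hD : IsPenalty D)
    (hc : StrictConvexOn ℝ (Ici 0) D) (hν : 0 < ν) (hμ : 0 ≤ μ)
    (htop : Tendsto (deriv D) atTop atTop) : ∃ a b, TangentPair U D θ ν μ a b := by
  -- Far out on the loss branch, at `a₀ = θ - t`, the slope exceeds `U'(1)`, so the parallel gain
  -- tangent touches at some `x < 1`. It also exceeds `U 1 + μ + ν D 1`, which together with
  -- convexity, `D t ≤ D 1 + D'(t) (t - 1)`, puts that tangent below the loss branch at `a₀`.
  obtain ⟨t, ht0, ht⟩ := ((eventually_gt_atTop (0 : ℝ)).and (htop.eventually_gt_atTop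
    (max (deriv U 1) (U 1 + μ + ν * D 1) / ν))).exists
  rw [div_lt_iff₀ hν, mul_comm (deriv D t), max_lt_iff] at ht
  obtain ⟨hs1, hs2⟩ := ht
  have hδ : 0 < ν * deriv D t := (hU.deriv_pos one_pos).trans hs1
  have h2 := hU.deriv_derivInv hδ
  have h3 := hU.derivInv_pos hδ
  obtain ⟨x, hx⟩ : ∃ x, x = derivInv U (ν * deriv D t) := ⟨_, rfl⟩
  rw [← hx] at h2 h3
  have h4 : x < 1 := by rwa [← hU.deriv_lt_iff one_pos h3, h2]
  have h5 := hU.strictMonoOn (mem_Ici.2 h3.le) (mem_Ici.2 zero_le_one) h4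
  have h6 := mul_le_mul_of_nonneg_left (hD.tangent_le hc ht0 zero_le_one) hν.le
  obtain ⟨a, b, h, -⟩ := exists_tangentPair_gt hU hD hc hν hμ (θ := θ) (a₀ := θ - t) (b₀ := x + θ)
    (by linarith) (by linarith) (by rw [sub_sub_cancel, add_sub_cancel_right, h2])
    (by rw [sub_sub_cancel, add_sub_cancel_right, h2]; nlinarith [mul_pos hδ h3])
  exact ⟨a, b, h⟩

/-- A tangent to the gain branch through the point `a₀` of the loss branch is at least as steep as
the loss branch there, unless there is a tangency pair to the right of `a₀`. -/
theorem deriv_loss_le_of_no_tangentPair (hU : IsReward U) (hD : IsPenalty D)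
    (hc : StrictConvexOn ℝ (Ici 0) D) (hν : 0 ≤ ν) (hμ : 0 ≤ μ) {a₀ z : ℝ} (ha₀ : a₀ < θ)
    (hz : θ < z) (he : deriv U (z - θ) * (z - a₀) = U (z - θ) + μ + ν * D (θ - a₀))
    (hno : ¬ ∃ a b, TangentPair U D θ ν μ a b ∧ a₀ < a) :
    ν * deriv D (θ - a₀) ≤ deriv U (z - θ) := by
  by_contra hlt
  have hlt := not_le.1 hlt
  have hδ := (hU.deriv_pos (sub_pos.2 hz)).trans hlt
  have hν' : 0 < ν := by
    refine lt_of_le_of_ne hν ?_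
    rintro rfl
    simp at hδ
  obtain ⟨x, hx, hxe⟩ := hU.exists_deriv_eq hδ
  have hxz : x < z - θ := by rwa [← hU.deriv_lt_iff (sub_pos.2 hz) hx, hxe]
  -- The parallel gain tangent touches left of `z`, hence passes strictly below the point of the
  -- loss branch at `a₀`.
  have h1 := hU.tangentGap_shift_lt ha₀.le (show θ < x + θ by linarith)
    (show x + θ < z by linarith)
  refine hno (exists_tangentPair_gt hU hD hc hν' hμ ha₀ (b₀ := x + θ) (by linarith)
    (by rw [add_sub_cancel_right, hxe]) ?_)
  linarith

end Tangency

/-! ### The objective function -/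

/-- The standing assumptions on the functions and the parameters. -/
structure Market (U D : ℝ → ℝ) (θ L ν lam : ℝ) : Prop where
  reward : IsReward U
  penalty : IsPenalty D
  theta_pos : 0 < θ
  level_pos : 0 < L
  nu_nonneg : 0 ≤ ν
  lam_nonneg : 0 ≤ lam

namespace Market

variable {U D : ℝ → ℝ} {θ L ν lam : ℝ}

theorem fNu_gain (h : Market U D θ L ν lam) {x : ℝ} (hx : θ ≤ x) :
    fNu U D θ ν x = U (x - θ) := by
  simp [fNu, max_eq_left (sub_nonneg.2 hx), max_eq_right (sub_nonpos.2 hx), h.penalty.map_zero]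

theorem fNu_loss (h : Market U D θ L ν lam) {x : ℝ} (hx : x ≤ θ) :
    fNu U D θ ν x = -(ν * D (θ - x)) := by
  simp [fNu, max_eq_left (sub_nonneg.2 hx), max_eq_right (sub_nonpos.2 hx), h.reward.map_zero]

theorem apply_of_lt {x : ℝ} (hx : x < L) : fNuLam U D θ L ν lam x = fNu U D θ ν x := by
  simp [fNuLam, hx]

theorem apply_of_le {x : ℝ} (hx : L ≤ x) : fNuLam U D θ L ν lam x = fNu U D θ ν x + lam := by
  simp [fNuLam, hx]

theorem apply_le (h : Market U D θ L ν lam) (x : ℝ) :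
    fNuLam U D θ L ν lam x ≤ fNu U D θ ν x + lam := by
  rcases lt_or_ge x L with hx | hx
  · rw [apply_of_lt hx]; linarith [h.lam_nonneg]
  · rw [apply_of_le hx]

theorem gain_lt (h : Market U D θ L ν lam) {x : ℝ} (hx : θ ≤ x) (hxL : x < L) :
    fNuLam U D θ L ν lam x = U (x - θ) := by
  rw [apply_of_lt hxL, h.fNu_gain hx]

theorem gain_ge (h : Market U D θ L ν lam) {x : ℝ} (hx : θ ≤ x) (hxL : L ≤ x) :
    fNuLam U D θ L ν lam x = U (x - θ) + lam := by
  rw [apply_of_le hxL, h.fNu_gain hx]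

theorem gain_le (h : Market U D θ L ν lam) {x : ℝ} (hx : θ ≤ x) :
    fNuLam U D θ L ν lam x ≤ U (x - θ) + lam :=
  (h.apply_le x).trans_eq (by rw [h.fNu_gain hx])

theorem loss_lt (h : Market U D θ L ν lam) {x : ℝ} (hx : x ≤ θ) (hxL : x < L) :
    fNuLam U D θ L ν lam x = -(ν * D (θ - x)) := by
  rw [apply_of_lt hxL, h.fNu_loss hx]

theorem loss_ge (h : Market U D θ L ν lam) {x : ℝ} (hx : x ≤ θ) (hxL : L ≤ x) :
    fNuLam U D θ L ν lam x = -(ν * D (θ - x)) + lam := by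
  rw [apply_of_le hxL, h.fNu_loss hx]

theorem apply_zero (h : Market U D θ L ν lam) : fNuLam U D θ L ν lam 0 = -(ν * D θ) := by
  rw [h.loss_lt h.theta_pos.le h.level_pos, sub_zero]

theorem kSlope_mul (h : Market U D θ L ν lam) :
    kSlope U D θ L ν lam * L = fNuLam U D θ L ν lam L + ν * D θ := by
  rw [kSlope, div_mul_cancel₀ _ h.level_pos.ne', apply_of_le le_rfl]

/-- Without a VaR multiplier the level is irrelevant. -/
theorem fNuLam_zero (L' : ℝ) : fNuLam U D θ L ν 0 = fNuLam U D θ L' ν 0 := by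
  ext x; simp [fNuLam]

end Market

theorem TangentLoss.mul_eq {U D : ℝ → ℝ} {θ L ν lam z : ℝ} (h : TangentLoss U D θ L ν lam z) :
    ν * deriv D (θ - z) * (L - z) = fNuLam U D θ L ν lam L + ν * D (θ - z) := by
  have h1 := h.2.2
  have h2 := lt_min_iff.1 h.2.1
  rwa [eq_div_iff (by linarith), ← Market.apply_of_le le_rfl] at h1

namespace Market

variable {U D : ℝ → ℝ} {θ L ν lam : ℝ}

/-! ### Tangents to the loss branch through the jump point -/

theorem kSlope_pos (h : Market U D θ L ν lam) (hlam : 0 < lam) : 0 < kSlope U D θ L ν lam := by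
  refine div_pos ?_ h.level_pos
  have hD := mul_nonneg h.nu_nonneg (h.penalty.nonneg h.theta_pos.le)
  rcases le_total L θ with hL | hL
  · rw [h.fNu_loss hL]
    have := mul_le_mul_of_nonneg_left (h.penalty.strictMonoOn.monotoneOn
      (mem_Ici.2 (sub_nonneg.2 hL)) (mem_Ici.2 h.theta_pos.le)
      (sub_le_self θ h.level_pos.le)) h.nu_nonneg
    linarith
  · rw [h.fNu_gain hL]
    have := h.reward.strictMonoOn.monotoneOn self_mem_Ici (mem_Ici.2 (sub_nonneg.2 hL))
      (sub_nonneg.2 hL)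
    rw [h.reward.map_zero] at this
    linarith

theorem nu_pos (h : Market U D θ L ν lam) (hlam : 0 < lam)
    (hk : kSlope U D θ L ν lam ≤ ν * deriv D θ) : 0 < ν := by
  refine lt_of_le_of_ne h.nu_nonneg ?_
  rintro rfl
  have := h.kSlope_pos hlam
  rw [zero_mul] at hk
  linarith

/-- These are heights at `L` of tangents to the loss branch; they sink as the contact point moves
right towards `L`. -/
theorem lossGap_lt (h : Market U D θ L ν lam) (hc : StrictConvexOn ℝ (Ici 0) D) (hν : 0 < ν)
    {z w : ℝ} (hzw : z < w) (hwL : w ≤ L) (hw : w < θ) :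
    ν * deriv D (θ - w) * (L - w) - ν * D (θ - w) <
      ν * deriv D (θ - z) * (L - z) - ν * D (θ - z) := by
  have h1 := h.penalty.neg_lt_tangent_shift hc hν (hzw.trans hw) hw.le hzw.ne'
  have h2 := h.penalty.deriv_shift_lt hc hν hzw hw
  nlinarith [mul_nonneg (sub_nonneg.2 hwL) (sub_pos.2 h2).le]

theorem tangentLoss_unique (h : Market U D θ L ν lam) (hc : StrictConvexOn ℝ (Ici 0) D)
    (hν : 0 < ν) {z w : ℝ} (hz : TangentLoss U D θ L ν lam z) (hw : TangentLoss U D θ L ν lam w) :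
    z = w := by
  have key : ∀ z w, TangentLoss U D θ L ν lam z → TangentLoss U D θ L ν lam w → ¬ z < w := by
    intro z w hz hw hzw
    have hw' := lt_min_iff.1 hw.2.1
    have h1 := h.lossGap_lt hc hν hzw hw'.1.le hw'.2
    have h2 := hz.mul_eq
    have h3 := hw.mul_eq
    linarith
  exact le_antisymm (not_lt.1 (key w z hw hz)) (not_lt.1 (key z w hz hw))

theorem exists_tangentLoss (h : Market U D θ L ν lam) (hlam : 0 < lam)
    (hk : kSlope U D θ L ν lam ≤ ν * deriv D θ) {a : ℝ} (ha : 0 ≤ a) (haL : a ≤ L) (haθ : a < θ)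
    (hlt : ν * deriv D (θ - a) * (L - a) - ν * D (θ - a) ≤ fNuLam U D θ L ν lam L) :
    ∃ z, TangentLoss U D θ L ν lam z := by
  have hs : ∀ x ∈ Icc 0 a, 0 < θ - x := fun x hx => sub_pos.2 (hx.2.trans_lt haθ)
  have hcont : ContinuousOn (fun x => ν * deriv D (θ - x) * (L - x) - ν * D (θ - x)) (Icc 0 a) := by
    refine ContinuousOn.sub (ContinuousOn.mul (continuousOn_const.mul ?_) ?_)
      (continuousOn_const.mul ?_)
    · exact h.penalty.deriv_continuousOn.comp (continuousOn_const.sub continuousOn_id) hs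
    · exact continuousOn_const.sub continuousOn_id
    · exact h.penalty.continuousOn.comp (continuousOn_const.sub continuousOn_id)
        fun x hx => (hs x hx).le
  -- The bound on `k` says that the loss tangent at `0` passes at or above the jump point; `hlt`
  -- says that the one at `a` passes at or below it.
  have hk' := mul_le_mul_of_nonneg_right hk h.level_pos.le
  rw [h.kSlope_mul] at hk'
  obtain ⟨z, ⟨hz0, hza⟩, hz⟩ := intermediate_value_Icc' ha hcont
    ⟨hlt, by simp only [sub_zero]; linarith⟩
  simp only at hz
  -- At `z = L` the height would be that of the loss branch itself, which is `λ > 0` below the jump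
  -- point.
  have hzL : z < L := by
    refine lt_of_le_of_ne (hza.trans haL) ?_
    rintro rfl
    rw [h.loss_ge (hza.trans haθ.le) le_rfl] at hz
    linarith
  refine ⟨z, hz0, lt_min hzL (hza.trans_lt haθ), ?_⟩
  rw [eq_div_iff (by linarith), ← apply_of_le le_rfl]
  linarith

theorem existsUnique_tangentLoss (h : Market U D θ L ν lam) (hc : StrictConvexOn ℝ (Ici 0) D)
    (hlam : 0 < lam) (hk : kSlope U D θ L ν lam ≤ ν * deriv D θ) (hL : L < θ) :
    ∃! z, TangentLoss U D θ L ν lam z := by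
  obtain ⟨z, hz⟩ := h.exists_tangentLoss hlam hk h.level_pos.le le_rfl hL (by
    rw [h.loss_ge hL.le le_rfl]; linarith)
  exact ⟨z, hz, fun w hw => h.tangentLoss_unique hc (h.nu_pos hlam hk) hw hz⟩

/-- As the contact point tends to `θ`, the loss tangent's height at `L` decreases to `ν * d * (L -
θ)`; comparing this limit with the jump point decides existence. The limit `D'(0+)` is finite
because `D'` is increasing and nonnegative. -/
theorem exists_tangentLoss_iff (h : Market U D θ L ν lam) (hc : StrictConvexOn ℝ (Ici 0) D)
    (hlam : 0 < lam) (hk : kSlope U D θ L ν lam ≤ ν * deriv D θ) (hL : θ < L) {d : ℝ}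
    (hd : Tendsto (deriv D) (𝓝[>] 0) (𝓝 d)) :
    (∃ z, TangentLoss U D θ L ν lam z) ↔ ν * d * (L - θ) < U (L - θ) + lam := by
  have hν := h.nu_pos hlam hk
  have hfL := h.gain_ge hL.le le_rfl
  have hlim : Tendsto (fun t => ν * deriv D t * (L - θ + t) - ν * D t) (𝓝[>] 0)
      (𝓝 (ν * d * (L - θ))) := by
    have h1 : Tendsto D (𝓝[>] 0) (𝓝 0) := by
      have := (h.penalty.continuousOn 0 self_mem_Ici).mono_left
        (nhdsWithin_mono 0 Ioi_subset_Ici_self)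
      rwa [h.penalty.map_zero] at this
    have h2 : Tendsto (fun t : ℝ => t) (𝓝[>] 0) (𝓝 0) := tendsto_id.mono_left nhdsWithin_le_nhds
    have := ((hd.const_mul ν).mul (h2.const_add (L - θ))).sub (h1.const_mul ν)
    simpa using this
  constructor
  · rintro ⟨z, hz⟩
    have hzθ := (lt_min_iff.1 hz.2.1).2
    -- Passing through the midpoint keeps the inequality strict in the limit.
    have hw := h.lossGap_lt hc hν (show z < (z + θ) / 2 by linarith) (by linarith) (by linarith)
    have hle := le_of_tendsto hlim (b := ν * deriv D (θ - (z + θ) / 2) * (L - (z + θ) / 2) -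
        ν * D (θ - (z + θ) / 2)) (by
      filter_upwards [Ioo_mem_nhdsGT (show (0 : ℝ) < θ - (z + θ) / 2 by linarith)] with t ht
      have := h.lossGap_lt hc hν (show (z + θ) / 2 < θ - t by linarith [ht.2])
        (by linarith [ht.1]) (by linarith [ht.1])
      rw [sub_sub_cancel, show L - (θ - t) = L - θ + t by ring] at this
      exact this.le)
    have := hz.mul_eq
    linarith
  · intro hlt
    by_contra hno
    refine absurd (ge_of_tendsto hlim (b := U (L - θ) + lam) ?_) (not_le.2 hlt)
    filter_upwards [Ioo_mem_nhdsGT h.theta_pos] with t ht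
    by_contra hlt
    refine hno (h.exists_tangentLoss hlam hk (a := θ - t) (by linarith [ht.2])
      (by linarith [ht.1]) (by linarith [ht.1]) ?_)
    rw [sub_sub_cancel, show L - (θ - t) = L - θ + t by ring, hfL]
    exact (not_le.1 hlt).le

/-! ### Tangents to the gain branch through the jump point -/

theorem existsUnique_levelTangent (h : Market U D θ L ν lam) (hlam : 0 < lam) (hL : θ < L) :
    ∃! z, θ < z ∧ z < L ∧
      deriv U (z - θ) = (U (L - θ) + lam - U (z - θ)) / (L - z) := by
  have hU := h.reward
  have hM : 0 < L - θ := sub_pos.2 hL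
  -- For `a < (L - θ) / 2` the tangent still has more than half the distance to run, so this slope
  -- lifts it above the jump point.
  obtain ⟨a, ha, ha1, ha2⟩ := hU.exists_deriv_gt (half_pos hM)
    ((U (L - θ) + lam) / ((L - θ) / 2))
  rw [div_lt_iff₀ (half_pos hM)] at ha2
  have h0 : 0 ≤ U a := by
    have := hU.strictMonoOn.monotoneOn self_mem_Ici (mem_Ici.2 ha.le) ha.le
    rwa [hU.map_zero] at this
  obtain ⟨x, hx1, hx2, hx⟩ := hU.exists_chordGap_eq (M := L - θ) (t := U (L - θ) + lam) ha
    (by linarith) (by linarith) (by nlinarith [hU.deriv_pos ha])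
  have hx0 := ha.trans_le hx1
  have hxM : x < L - θ := by
    refine lt_of_le_of_ne hx2 ?_
    rintro rfl
    linarith
  refine ⟨x + θ, ⟨by linarith, by linarith, ?_⟩, ?_⟩
  · rw [eq_div_iff (by linarith), add_sub_cancel_right]
    linarith
  · rintro y ⟨hy1, hy2, hy⟩
    rw [eq_div_iff (by linarith)] at hy
    by_contra hne
    rcases lt_or_gt_of_ne (show y - θ ≠ x by intro h; apply hne; linarith) with hlt | hlt
    · have := hU.chordGap_lt (sub_pos.2 hy1) hlt hxM.le
      linarith
    · have := hU.chordGap_lt hx0 hlt (show y - θ ≤ L - θ by linarith)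
      linarith

/-! ### Building blocks of the solutions -/

theorem loss_tail (h : Market U D θ L ν lam) (hc : StrictConvexOn ℝ (Ici 0) D) (hν : 0 < ν)
    {z : ℝ} (hz : 0 ≤ z) (hzθ : z < θ) (hzL : z < L)
    (hdom : Dominates (fNuLam U D θ L ν lam) (ν * deriv D (θ - z)) z) :
    SolvesFrom (fNuLam U D θ L ν lam) (ν * deriv D (θ - z))
      [(lossPiece D θ ν, ν * deriv D θ)] := by
  have h0 : Dominates (fNuLam U D θ L ν lam) (ν * deriv D (θ - 0)) 0 := by
    refine hdom.steeper (h.penalty.deriv_shift_le hc hν.le hz hzθ) le_rfl fun x hx hxz => ?_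
    rw [h.loss_lt (hxz.trans hzθ.le) (hxz.trans_lt hzL), h.loss_lt h.theta_pos.le h.level_pos]
    exact h.penalty.neg_le_tangent_shift hc hν.le h.theta_pos (hxz.trans hzθ.le)
  have := SolvesFrom.loss_cons (κ := 0) h.penalty hc hν hz hzθ (fun x _ hxz => by
    rw [h.loss_lt (hxz.trans hzθ.le) (hxz.trans_lt hzL), add_zero]) hdom h0 h0.solvesFrom_nil
  rwa [sub_zero] at this

theorem loss_le_of_ge (h : Market U D θ L ν lam) (hc : StrictConvexOn ℝ (Ici 0) D) (hL : L < θ)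
    {x : ℝ} (hLx : L ≤ x) (hx : x ≤ θ) : fNuLam U D θ L ν lam x ≤
      fNuLam U D θ L ν lam L + ν * deriv D (θ - L) * (x - L) := by
  rw [h.loss_ge hx hLx, h.loss_ge hL.le le_rfl]
  linarith [h.penalty.neg_le_tangent_shift hc h.nu_nonneg hL hx]

/-- The solution given by a tangency pair that passes above the jump point. -/
theorem isSolution_pair (h : Market U D θ L ν lam) (hc : StrictConvexOn ℝ (Ici 0) D) {a b : ℝ}
    (hp : TangentPair U D θ ν lam a b) (ha : 0 ≤ a) (haL : a < L) (hLb : L ≤ b)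
    (hfL : L < θ → fNuLam U D θ L ν lam L ≤ -(ν * D (θ - a)) + ν * deriv D (θ - a) * (L - a)) :
    IsSolution (fNuLam U D θ L ν lam)
      [(gainPiece U θ, deriv U (b - θ)), (lossPiece D θ ν, ν * deriv D θ)] := by
  have hν := hp.nu_pos h.reward h.nu_nonneg
  have e := hp.mul_eq
  obtain ⟨haθ, hb, hs, -⟩ := hp
  have hfb := h.gain_ge hb.le hLb
  have hfa := h.loss_lt haθ.le haL
  have hdom : Dominates (fNuLam U D θ L ν lam) (deriv U (b - θ)) b := by
    refine ⟨h.theta_pos.le.trans hb.le, fun x hx => ?_⟩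
    rw [hfb]
    rcases le_or_gt θ x with hxθ | hxθ
    · have h1 := h.gain_le hxθ
      have h2 := h.reward.le_tangent_shift hb hxθ
      linarith
    rcases lt_or_ge x L with hxL | hxL
    · have h1 := h.penalty.neg_le_tangent_shift hc hν.le haθ hxθ.le
      rw [h.loss_lt hxθ.le hxL]
      rw [hs] at h1
      linarith
    · have hLθ := hxL.trans_lt hxθ
      -- Beyond `L` the raised loss branch lies below its tangent at `L`, which is flatter than the
      -- pair's line; only the jump point has to be tested.
      have h1 := h.loss_le_of_ge hc hLθ hxL hxθ.le
      have h2 := h.penalty.deriv_shift_le hc hν.le haL.le hLθ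
      have h3 := hfL hLθ
      rw [hs] at h2 h3
      nlinarith [mul_nonneg (sub_nonneg.2 h2) (sub_nonneg.2 hxL)]
  have hdom' := hdom.of_touch (q := a) ha (by rw [hfa, hfb]; linarith)
  refine isSolution_gain_cons (κ := lam) h.reward hb
    (fun x hx => h.gain_ge (hb.le.trans hx) (hLb.trans hx)) hdom ?_
  rw [← hs] at hdom' ⊢
  exact h.loss_tail hc hν ha haθ haL hdom'

/-- The solution given by the tangent from the origin that passes above the jump point. -/
theorem isSolution_zero (h : Market U D θ L ν lam) {z : ℝ} (hz : TangentZero U D θ ν lam z)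
    (hLz : L ≤ z) (hx : ∀ x, 0 ≤ x → x < θ →
      fNuLam U D θ L ν lam x ≤ -(ν * D θ) + deriv U (z - θ) * x) :
    IsSolution (fNuLam U D θ L ν lam) [(gainPiece U θ, deriv U (z - θ))] := by
  have e := hz.mul_eq h.theta_pos
  have hθz := hz.1
  have hfz := h.gain_ge hθz.le hLz
  have hdom : Dominates (fNuLam U D θ L ν lam) (deriv U (z - θ)) z := by
    refine ⟨h.theta_pos.le.trans hθz.le, fun x hx0 => ?_⟩
    rw [hfz]
    rcases le_or_gt θ x with hxθ | hxθ
    · have h1 := h.gain_le hxθ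
      have h2 := h.reward.le_tangent_shift hθz hxθ
      linarith
    · have := hx x hx0 hxθ
      linarith
  refine isSolution_gain_cons (κ := lam) h.reward hθz
    (fun x hx => h.gain_ge (hθz.le.trans hx) (hLz.trans hx)) hdom ?_
  refine (hdom.of_touch le_rfl ?_).solvesFrom_nil
  rw [hfz, h.apply_zero]
  linarith

theorem loss_le_of_slope (h : Market U D θ L ν lam) (hc : StrictConvexOn ℝ (Ici 0) D) {s : ℝ}
    (hs : ν * deriv D θ ≤ s) (hfL : L < θ → fNuLam U D θ L ν lam L ≤ -(ν * D θ) + s * L) {x : ℝ}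
    (hx : 0 ≤ x) (hxθ : x < θ) : fNuLam U D θ L ν lam x ≤ -(ν * D θ) + s * x := by
  rcases lt_or_ge x L with hxL | hxL
  · have h1 := h.penalty.neg_le_tangent_shift hc h.nu_nonneg h.theta_pos hxθ.le
    rw [sub_zero, sub_zero] at h1
    rw [h.loss_lt hxθ.le hxL]
    nlinarith [mul_nonneg (sub_nonneg.2 hs) hx]
  · have hLθ := hxL.trans_lt hxθ
    have h1 := h.loss_le_of_ge hc hLθ hxL hxθ.le
    have h2 := h.penalty.deriv_shift_le hc h.nu_nonneg h.level_pos.le hLθ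
    have h3 := hfL hLθ
    rw [sub_zero] at h2
    nlinarith [mul_nonneg (sub_nonneg.2 (h2.trans hs)) (sub_nonneg.2 hxL)]

/-- The supporting line pivots at the jump point until its slope is `k`, when it also touches at the
origin. In `level_tail_loss` it meets the loss branch first. -/
theorem level_tail_zero (h : Market U D θ L ν lam) {c k : ℝ} (hk : k = kSlope U D θ L ν lam)
    (hck : c ≤ k) (hdom : Dominates (fNuLam U D θ L ν lam) c L) (hx : ∀ x, 0 ≤ x → x < L →
      fNuLam U D θ L ν lam x ≤ fNuLam U D θ L ν lam L + k * (x - L)) :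
    SolvesFrom (fNuLam U D θ L ν lam) c [(fun _ => L, k)] := by
  have h1 : Dominates (fNuLam U D θ L ν lam) k L := by
    refine hdom.steeper hck h.level_pos.le fun x hx0 hxL => ?_
    rcases hxL.eq_or_lt with rfl | hxL
    · simp
    · exact hx x hx0 hxL
  refine SolvesFrom.const_cons hck hdom h1 (h1.of_touch le_rfl ?_).solvesFrom_nil
  have := h.kSlope_mul
  rw [h.apply_zero, hk]
  linarith

theorem level_tail_loss (h : Market U D θ L ν lam) (hc : StrictConvexOn ℝ (Ici 0) D) (hν : 0 < ν)
    {c z : ℝ} (hz : TangentLoss U D θ L ν lam z) (hcz : c ≤ ν * deriv D (θ - z))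
    (hdom : Dominates (fNuLam U D θ L ν lam) c L) (hx : ∀ x, θ ≤ x → x < L →
      U (x - θ) ≤ fNuLam U D θ L ν lam L + ν * deriv D (θ - z) * (x - L)) :
    SolvesFrom (fNuLam U D θ L ν lam) c
      [(fun _ => L, ν * deriv D (θ - z)), (lossPiece D θ ν, ν * deriv D θ)] := by
  have e := hz.mul_eq
  obtain ⟨hzL, hzθ⟩ := lt_min_iff.1 hz.2.1
  have h1 : Dominates (fNuLam U D θ L ν lam) (ν * deriv D (θ - z)) L := by
    refine hdom.steeper hcz h.level_pos.le fun x hx0 hxL => ?_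
    rcases hxL.eq_or_lt with rfl | hxL
    · simp
    rcases le_or_gt θ x with hxθ | hxθ
    · rw [h.gain_lt hxθ hxL]
      exact hx x hxθ hxL
    · rw [h.loss_lt hxθ.le hxL]
      have := h.penalty.neg_le_tangent_shift hc hν.le hzθ hxθ.le
      linarith
  refine SolvesFrom.const_cons hcz hdom h1 (h.loss_tail hc hν hz.1 hzθ hzL (h1.of_touch hz.1 ?_))
  rw [h.loss_lt hzθ.le hzL]
  linarith

/-- A tangency pair to the right of the level: the solution down to the level. -/
theorem isSolution_pair_level (h : Market U D θ L ν lam) (hc : StrictConvexOn ℝ (Ici 0) D)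
    {a b : ℝ} (hp : TangentPair U D θ ν 0 a b) (hLa : L < a) {rest : List ((ℝ → ℝ) × ℝ)}
    (hrest : Dominates (fNuLam U D θ L ν lam) (ν * deriv D (θ - L)) L →
      SolvesFrom (fNuLam U D θ L ν lam) (ν * deriv D (θ - L)) rest) :
    IsSolution (fNuLam U D θ L ν lam) ((gainPiece U θ, deriv U (b - θ)) ::
      (lossPiece D θ ν, ν * deriv D (θ - L)) :: rest) := by
  have hν := hp.nu_pos h.reward h.nu_nonneg
  have e := hp.mul_eq
  obtain ⟨haθ, hb, hs, -⟩ := hp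
  have hfb := h.gain_ge hb.le (hLa.trans (haθ.trans hb)).le
  have hfa := h.loss_ge haθ.le hLa.le
  have hLθ := hLa.trans haθ
  have hdom : Dominates (fNuLam U D θ L ν lam) (deriv U (b - θ)) b := by
    refine ⟨h.theta_pos.le.trans hb.le, fun x hx => (h.apply_le x).trans ?_⟩
    rw [hfb]
    rcases le_total θ x with hxθ | hxθ
    · have h2 := h.reward.le_tangent_shift hb hxθ
      rw [h.fNu_gain hxθ]
      linarith
    · have h1 := h.penalty.neg_le_tangent_shift hc hν.le haθ hxθ
      rw [h.fNu_loss hxθ]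
      rw [hs] at h1
      linarith
  have hdoma := hdom.of_touch (q := a) (h.level_pos.le.trans hLa.le) (by rw [hfa, hfb]; linarith)
  refine isSolution_gain_cons (κ := lam) h.reward hb
    (fun x hx => h.gain_ge (hb.le.trans hx) ((hLθ.trans hb).le.trans hx)) hdom ?_
  rw [← hs] at hdoma ⊢
  have hdomL : Dominates (fNuLam U D θ L ν lam) (ν * deriv D (θ - L)) L := by
    refine hdoma.steeper (h.penalty.deriv_shift_le hc hν.le hLa.le haθ) h.level_pos.le
      fun x hx hxa => ?_
    rcases le_or_gt L x with hxL | hxL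
    · exact h.loss_le_of_ge hc hLθ hxL (hxa.trans haθ.le)
    · have h1 := h.penalty.neg_le_tangent_shift hc hν.le hLθ (hxa.trans haθ.le)
      rw [h.loss_lt (hxa.trans haθ.le) hxL, h.loss_ge hLθ.le le_rfl]
      linarith [h.lam_nonneg]
  exact SolvesFrom.loss_cons (κ := lam) h.penalty hc hν hLa.le haθ
    (fun x hx hxa => h.loss_ge (hxa.trans haθ.le) hx) hdoma hdomL (hrest hdomL)

/-- A tangent to the gain branch from the jump point at a level below the threshold: the
solution down to the level. -/
theorem isSolution_level_lt (h : Market U D θ L ν lam) (hL : L < θ) {z : ℝ} (hz : θ < z)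
    (e : deriv U (z - θ) * (z - L) = U (z - θ) + ν * D (θ - L))
    (hx : ∀ x, L ≤ x → x < θ → fNuLam U D θ L ν lam x ≤
      fNuLam U D θ L ν lam L + deriv U (z - θ) * (x - L))
    (hx' : ∀ x, 0 ≤ x → x < L → fNuLam U D θ L ν lam x ≤
      fNuLam U D θ L ν lam L + deriv U (z - θ) * (x - L)) {rest : List ((ℝ → ℝ) × ℝ)}
    (hrest : Dominates (fNuLam U D θ L ν lam) (deriv U (z - θ)) L →
      SolvesFrom (fNuLam U D θ L ν lam) (deriv U (z - θ)) rest) :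
    IsSolution (fNuLam U D θ L ν lam) ((gainPiece U θ, deriv U (z - θ)) :: rest) := by
  have hLz := (hL.trans hz).le
  have hfz := h.gain_ge hz.le hLz
  have hfL := h.loss_ge hL.le le_rfl
  have hdom : Dominates (fNuLam U D θ L ν lam) (deriv U (z - θ)) L := by
    refine ⟨h.level_pos.le, fun x hx0 => ?_⟩
    rcases lt_or_ge x L with hxL | hxL
    · exact hx' x hx0 hxL
    rcases lt_or_ge x θ with hxθ | hxθ
    · exact hx x hxL hxθ
    · have := h.reward.le_tangent_shift hz hxθ
      rw [h.gain_ge hxθ hxL, hfL]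
      linarith
  refine isSolution_gain_cons (κ := lam) h.reward hz
    (fun x hx => h.gain_ge (hz.le.trans hx) (hLz.trans hx))
    (hdom.of_touch (h.theta_pos.trans hz).le ?_) (hrest hdom)
  rw [hfz, hfL]
  linarith

theorem isSolution_level_gt (h : Market U D θ L ν lam) (hL : θ < L)
    (hx : ∀ x, 0 ≤ x → x < L → fNuLam U D θ L ν lam x ≤
      fNuLam U D θ L ν lam L + deriv U (L - θ) * (x - L)) {rest : List ((ℝ → ℝ) × ℝ)}
    (hrest : Dominates (fNuLam U D θ L ν lam) (deriv U (L - θ)) L →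
      SolvesFrom (fNuLam U D θ L ν lam) (deriv U (L - θ)) rest) :
    IsSolution (fNuLam U D θ L ν lam) ((gainPiece U θ, deriv U (L - θ)) :: rest) := by
  have hfL := h.gain_ge hL.le le_rfl
  have hdom : Dominates (fNuLam U D θ L ν lam) (deriv U (L - θ)) L := by
    refine ⟨h.level_pos.le, fun x hx0 => ?_⟩
    rcases lt_or_ge x L with hxL | hxL
    · exact hx x hx0 hxL
    · have := h.reward.le_tangent_shift hL (hL.le.trans hxL)
      rw [h.gain_ge (hL.le.trans hxL) hxL, hfL]
      linarith
  exact isSolution_gain_cons (κ := lam) h.reward hL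
    (fun x hx => h.gain_ge (hL.le.trans hx) hx) hdom (hrest hdom)

/-- A tangent to the gain branch from the jump point at a level above the threshold: the
solution down to the tangent to the gain branch from below. -/
theorem isSolution_level_levelTangent (h : Market U D θ L ν lam) {w z : ℝ} (hz : θ < z)
    (hzw : z ≤ w) (hwL : w ≤ L)
    (e : deriv U (w - θ) * (L - w) = U (L - θ) + lam - U (w - θ))
    (hx : ∀ x, 0 ≤ x → x < θ → -(ν * D (θ - x)) ≤ U (z - θ) + deriv U (z - θ) * (x - z))
    {rest : List ((ℝ → ℝ) × ℝ)}
    (hrest : Dominates (fNuLam U D θ L ν lam) (deriv U (z - θ)) z →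
      SolvesFrom (fNuLam U D θ L ν lam) (deriv U (z - θ)) rest) :
    IsSolution (fNuLam U D θ L ν lam) ((gainPiece U θ, deriv U (L - θ)) ::
      (fun _ => L, deriv U (w - θ)) :: (gainPiece U θ, deriv U (z - θ)) :: rest) := by
  have hU := h.reward
  have hw := hz.trans_le hzw
  have hθL := hw.trans_le hwL
  have hfL := h.gain_ge hθL.le le_rfl
  have hgain : ∀ x, θ ≤ x → x ≤ w → fNuLam U D θ L ν lam x = U (x - θ) + 0 := by
    intro x hx hxw
    rcases (hxw.trans hwL).eq_or_lt with rfl | hxL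
    · obtain rfl : x = w := le_antisymm hxw hwL
      rw [hfL]
      linarith
    · rw [h.gain_lt hx hxL, add_zero]
  have hfw := hgain w hw.le le_rfl
  have hfz := hgain z hz.le hzw
  rw [add_zero] at hfw hfz
  have hLw := (hU.deriv_shift_le_iff hθL hw).2 hwL
  have hwz := (hU.deriv_shift_le_iff hw hz).2 hzw
  have hline : ∀ x, θ ≤ x →
      fNuLam U D θ L ν lam x ≤ U (w - θ) + deriv U (w - θ) * (x - w) := by
    intro x hx
    rcases lt_or_ge x L with hxL | hxL
    · rw [h.gain_lt hx hxL]
      exact hU.le_tangent_shift hw hx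
    · have h1 := hU.le_tangent_shift hθL hx
      rw [h.gain_ge hx hxL]
      nlinarith [mul_nonneg (sub_nonneg.2 hLw) (sub_nonneg.2 hxL)]
  have hdomz : Dominates (fNuLam U D θ L ν lam) (deriv U (z - θ)) z := by
    refine ⟨(h.theta_pos.trans hz).le, fun x hx0 => ?_⟩
    rw [hfz]
    rcases lt_or_ge x θ with hxθ | hxθ
    · rw [h.loss_lt hxθ.le (hxθ.trans hθL)]
      exact hx x hx0 hxθ
    rcases le_total x w with hxw | hxw
    · rw [hgain x hxθ hxw, add_zero]
      exact hU.le_tangent_shift hz hxθ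
    · have h1 := hline x hxθ
      have h2 := hU.le_tangent_shift hz hw.le
      nlinarith [mul_nonneg (sub_nonneg.2 hwz) (sub_nonneg.2 hxw)]
  have hdomw : Dominates (fNuLam U D θ L ν lam) (deriv U (w - θ)) w :=
    hdomz.flatter hwz hzw fun x hx => by rw [hfw]; exact hline x (hz.le.trans hx)
  have hdomL := hdomw.of_touch (q := L) h.level_pos.le (by rw [hfw, hfL]; linarith)
  refine h.isSolution_level_gt hθL (fun x hx hxL => ?_) fun hdom => ?_
  · have := hdomL.2 x hx
    nlinarith [mul_nonneg (sub_nonneg.2 hLw) (sub_pos.2 hxL).le]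
  · exact SolvesFrom.const_cons hLw hdom hdomL (SolvesFrom.gain_cons (κ := 0) hU hz hzw
      (fun x hx hxw => hgain x (hz.le.trans hx) hxw) hdomw hdomz (hrest hdomz))

theorem isSolution_level_levelTangent_zero (h : Market U D θ L ν lam) {w z : ℝ}
    (hz : TangentZero U D θ ν 0 z) (hzw : z ≤ w) (hwL : w ≤ L)
    (e : deriv U (w - θ) * (L - w) = U (L - θ) + lam - U (w - θ))
    (hx : ∀ x, 0 ≤ x → x < θ → -(ν * D (θ - x)) ≤ -(ν * D θ) + deriv U (z - θ) * x) :
    IsSolution (fNuLam U D θ L ν lam) [(gainPiece U θ, deriv U (L - θ)),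
      (fun _ => L, deriv U (w - θ)), (gainPiece U θ, deriv U (z - θ))] := by
  have e' := hz.mul_eq h.theta_pos
  refine h.isSolution_level_levelTangent hz.1 hzw hwL e (fun x hx0 hxθ => ?_) fun hdom =>
    (hdom.of_touch le_rfl ?_).solvesFrom_nil
  · linarith [hx x hx0 hxθ]
  · have hfz : fNuLam U D θ L ν lam z = U (z - θ) := by
      rcases (hzw.trans hwL).eq_or_lt with rfl | hzL
      · obtain rfl : z = w := le_antisymm hzw hwL
        rw [h.gain_ge hz.1.le le_rfl]
        linarith
      · exact h.gain_lt hz.1.le hzL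
    rw [h.apply_zero, hfz]
    linarith

/-! ### Strictly convex penalty -/

section Convex

theorem deriv_theta_le (h : Market U D θ L ν lam) (hc : StrictConvexOn ℝ (Ici 0) D) {μ z : ℝ}
    (hμ : 0 ≤ μ) (hz : TangentZero U D θ ν μ z)
    (hno : ¬ ∃ a b, TangentPair U D θ ν μ a b ∧ 0 < a) : ν * deriv D θ ≤ deriv U (z - θ) := by
  have e := hz.mul_eq h.theta_pos
  have := deriv_loss_le_of_no_tangentPair h.reward h.penalty hc h.nu_nonneg hμ h.theta_pos hz.1
    (by rw [sub_zero, sub_zero]; exact e) hno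
  rwa [sub_zero] at this

theorem convex_lam_zero_pair (h : Market U D θ L ν 0) (hc : StrictConvexOn ℝ (Ici 0) D) {a b : ℝ}
    (hp : TangentPair U D θ ν 0 a b) (ha : 0 ≤ a) :
    IsSolution (fNuLam U D θ L ν 0)
      [(gainPiece U θ, deriv U (b - θ)), (lossPiece D θ ν, ν * deriv D θ)] := by
  -- With `λ = 0` the level may be moved to `θ`, where the condition on the jump point is vacuous.
  have h' : Market U D θ θ ν 0 := { h with level_pos := h.theta_pos }
  rw [fNuLam_zero θ]
  exact h'.isSolution_pair hc hp ha hp.1 hp.2.1.le fun hlt => absurd hlt (lt_irrefl _)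

theorem convex_lam_zero_zero (h : Market U D θ L ν 0) (hc : StrictConvexOn ℝ (Ici 0) D) {z : ℝ}
    (hno : ¬ ∃ a b, TangentPair U D θ ν 0 a b ∧ 0 ≤ a) (hz : TangentZero U D θ ν 0 z) :
    IsSolution (fNuLam U D θ L ν 0) [(gainPiece U θ, deriv U (z - θ))] := by
  have h' : Market U D θ θ ν 0 := { h with level_pos := h.theta_pos }
  have hs := h.deriv_theta_le hc le_rfl hz fun ⟨a, b, hp, ha⟩ => hno ⟨a, b, hp, ha.le⟩
  rw [fNuLam_zero θ]
  exact h'.isSolution_zero hz hz.1.le fun x hx hxθ =>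
    h'.loss_le_of_slope hc hs (fun hlt => absurd hlt (lt_irrefl _)) hx hxθ

theorem le_level_line (h : Market U D θ L ν lam) (hc : StrictConvexOn ℝ (Ici 0) D) {k : ℝ}
    (hk : k = kSlope U D θ L ν lam) (hδk : ν * deriv D θ ≤ k) {x : ℝ} (hx : 0 ≤ x) (hxθ : x ≤ θ)
    (hxL : x < L) :
    fNuLam U D θ L ν lam x ≤ fNuLam U D θ L ν lam L + k * (x - L) := by
  have h1 := h.penalty.neg_le_tangent_shift hc h.nu_nonneg h.theta_pos hxθ
  have h2 := h.kSlope_mul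
  rw [← hk] at h2
  rw [sub_zero, sub_zero] at h1
  rw [h.loss_lt hxθ hxL]
  nlinarith [mul_nonneg (sub_nonneg.2 hδk) hx]

theorem convex_low_zero (h : Market U D θ L ν lam) (hc : StrictConvexOn ℝ (Ici 0) D) {k a b : ℝ}
    (hk : k = kSlope U D θ L ν lam) (hp : TangentPair U D θ ν 0 a b) (hLa : L < a)
    (hδk : ν * deriv D θ < k) :
    IsSolution (fNuLam U D θ L ν lam) [(gainPiece U θ, deriv U (b - θ)),
      (lossPiece D θ ν, ν * deriv D (θ - L)), (fun _ => L, k)] := by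
  have hLθ := hLa.trans hp.1
  have h1 := h.penalty.deriv_shift_le hc h.nu_nonneg h.level_pos.le hLθ
  rw [sub_zero] at h1
  exact h.isSolution_pair_level hc hp hLa fun hdom => h.level_tail_zero hk (h1.trans hδk.le) hdom
    fun x hx hxL => h.le_level_line hc hk hδk.le hx (hxL.trans hLθ).le hxL

theorem convex_low_loss (h : Market U D θ L ν lam) (hc : StrictConvexOn ℝ (Ici 0) D) {a b z : ℝ}
    (hp : TangentPair U D θ ν 0 a b) (hLa : L < a) (hz : TangentLoss U D θ L ν lam z) :
    IsSolution (fNuLam U D θ L ν lam) [(gainPiece U θ, deriv U (b - θ)),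
      (lossPiece D θ ν, ν * deriv D (θ - L)), (fun _ => L, ν * deriv D (θ - z)),
      (lossPiece D θ ν, ν * deriv D θ)] := by
  have hLθ := hLa.trans hp.1
  exact h.isSolution_pair_level hc hp hLa fun hdom => h.level_tail_loss hc
    (hp.nu_pos h.reward h.nu_nonneg) hz
    (h.penalty.deriv_shift_le hc h.nu_nonneg (lt_min_iff.1 hz.2.1).1.le hLθ) hdom
    fun x hx hxL => absurd (hx.trans_lt hxL) (not_lt.2 hLθ.le)

/-! ### Strictly convex penalty, level below the threshold, no tangency pair beyond the level. -/

section Middle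

variable {w : ℝ}

theorem deriv_level_le (h : Market U D θ L ν lam) (hc : StrictConvexOn ℝ (Ici 0) D) (hL : L < θ)
    (hno : ¬ ∃ a b, TangentPair U D θ ν 0 a b ∧ L < a) (hw : θ < w)
    (e : deriv U (w - θ) * (w - L) = U (w - θ) + ν * D (θ - L)) :
    ν * deriv D (θ - L) ≤ deriv U (w - θ) :=
  deriv_loss_le_of_no_tangentPair h.reward h.penalty hc h.nu_nonneg le_rfl hL hw
    (by rw [add_zero]; exact e) hno

theorem convex_middle_level_zero (h : Market U D θ L ν lam) (hc : StrictConvexOn ℝ (Ici 0) D)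
    {k : ℝ} (hk : k = kSlope U D θ L ν lam) (hL : L < θ)
    (hno : ¬ ∃ a b, TangentPair U D θ ν 0 a b ∧ L < a) (hw : θ < w)
    (e : deriv U (w - θ) * (w - L) = U (w - θ) + ν * D (θ - L))
    (hδk : ν * deriv D θ < k) (hwk : deriv U (w - θ) < k) :
    IsSolution (fNuLam U D θ L ν lam) [(gainPiece U θ, deriv U (w - θ)), (fun _ => L, k)] := by
  have hδ := h.deriv_level_le hc hL hno hw e
  refine h.isSolution_level_lt hL hw e (fun x hLx hxθ => ?_) (fun x hx hxL => ?_) fun hdom =>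
    h.level_tail_zero hk hwk.le hdom fun x hx hxL =>
      h.le_level_line hc hk hδk.le hx (hxL.trans hL).le hxL
  · have h1 := h.loss_le_of_ge hc hL hLx hxθ.le
    nlinarith [mul_nonneg (sub_nonneg.2 hδ) (sub_nonneg.2 hLx)]
  · have h1 := h.le_level_line hc hk hδk.le hx (hxL.trans hL).le hxL
    nlinarith [mul_nonneg (sub_pos.2 hwk).le (sub_pos.2 hxL).le]

/-- If `k` is at most the slope of the tangent from the jump point, then it is at most the slope
of the tangent from the origin. -/
theorem kSlope_le_of_le_tangent (h : Market U D θ L ν lam) {k z : ℝ}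
    (hk : k = kSlope U D θ L ν lam) (hL : L < θ) (hw : θ < w)
    (e : deriv U (w - θ) * (w - L) = U (w - θ) + ν * D (θ - L))
    (hkw : k ≤ deriv U (w - θ)) (hz : TangentZero U D θ ν lam z) :
    w ≤ z ∧ k ≤ deriv U (z - θ) := by
  have ez := hz.mul_eq h.theta_pos
  have h2 := h.kSlope_mul
  rw [← hk, h.loss_ge hL.le le_rfl] at h2
  have hkL := mul_le_mul_of_nonneg_right hkw h.level_pos.le
  have hwz : w ≤ z := by
    refine h.reward.le_of_tangentGap_le h.theta_pos.le hz.1 ?_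
    linarith
  have hs := (h.reward.deriv_shift_le_iff hz.1 hw).2 hwz
  refine ⟨hwz, le_of_mul_le_mul_right ?_ h.level_pos⟩
  have h3 := h.reward.le_tangent_shift hz.1 hw.le
  nlinarith [mul_nonneg (sub_nonneg.2 hs) (sub_pos.2 (hL.trans hw)).le]

theorem convex_middle_zero (h : Market U D θ L ν lam) (hc : StrictConvexOn ℝ (Ici 0) D)
    {k z : ℝ} (hk : k = kSlope U D θ L ν lam) (hL : L < θ) (hw : θ < w)
    (e : deriv U (w - θ) * (w - L) = U (w - θ) + ν * D (θ - L))
    (hδk : ν * deriv D θ < k) (hkw : k ≤ deriv U (w - θ)) (hz : TangentZero U D θ ν lam z) :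
    IsSolution (fNuLam U D θ L ν lam) [(gainPiece U θ, deriv U (z - θ))] := by
  have hkz := (h.kSlope_le_of_le_tangent hk hL hw e hkw hz).2
  refine h.isSolution_zero hz (hL.trans hz.1).le fun x hx hxθ =>
    h.loss_le_of_slope hc (hδk.le.trans hkz) (fun _ => ?_) hx hxθ
  have h2 := h.kSlope_mul
  rw [← hk] at h2
  linarith [mul_le_mul_of_nonneg_right hkz h.level_pos.le]

theorem convex_middle_level_loss (h : Market U D θ L ν lam) (hc : StrictConvexOn ℝ (Ici 0) D)
    {z : ℝ} (hν : 0 < ν) (hL : L < θ)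
    (hno : ¬ ∃ a b, TangentPair U D θ ν 0 a b ∧ L < a) (hw : θ < w)
    (e : deriv U (w - θ) * (w - L) = U (w - θ) + ν * D (θ - L))
    (hz : TangentLoss U D θ L ν lam z) (hwz : deriv U (w - θ) < ν * deriv D (θ - z)) :
    IsSolution (fNuLam U D θ L ν lam) [(gainPiece U θ, deriv U (w - θ)),
      (fun _ => L, ν * deriv D (θ - z)), (lossPiece D θ ν, ν * deriv D θ)] := by
  have hδ := h.deriv_level_le hc hL hno hw e
  have ez := hz.mul_eq
  refine h.isSolution_level_lt hL hw e (fun x hLx hxθ => ?_) (fun x hx hxL => ?_) fun hdom =>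
    h.level_tail_loss hc hν hz hwz.le hdom
      fun x hx hxL => absurd (hx.trans_lt hxL) (not_lt.2 hL.le)
  · have h1 := h.loss_le_of_ge hc hL hLx hxθ.le
    nlinarith [mul_nonneg (sub_nonneg.2 hδ) (sub_nonneg.2 hLx)]
  · have h1 := h.penalty.neg_le_tangent_shift hc hν.le (lt_min_iff.1 hz.2.1).2 (hxL.trans hL).le
    rw [h.loss_lt (hxL.trans hL).le hxL]
    nlinarith [mul_nonneg (sub_pos.2 hwz).le (sub_pos.2 hxL).le]

/-- If the tangents from the jump point to the two branches meet at a convex kink, then every line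
above both branches passes above the jump point. -/
theorem level_le_line (hL : L < θ) (hw : θ < w) {z s c : ℝ}
    (h : Market U D θ L ν lam)
    (e : deriv U (w - θ) * (w - L) = U (w - θ) + ν * D (θ - L))
    (hz : TangentLoss U D θ L ν lam z) (hzw : ν * deriv D (θ - z) ≤ deriv U (w - θ))
    (h1 : -(ν * D (θ - z)) ≤ c + s * z) (h2 : U (w - θ) + lam ≤ c + s * w) :
    fNuLam U D θ L ν lam L ≤ c + s * L := by
  have ez := hz.mul_eq
  have hzL := (lt_min_iff.1 hz.2.1).1
  have hfL := h.loss_ge hL.le le_rfl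
  by_contra hlt
  have h3 : s < ν * deriv D (θ - z) := by
    refine lt_of_mul_lt_mul_right ?_ (sub_pos.2 hzL).le
    linarith
  have h4 : deriv U (w - θ) < s := by
    refine lt_of_mul_lt_mul_right ?_ (sub_pos.2 (hL.trans hw)).le
    linarith
  linarith

/-- Lowering the gain branch by `λ` pushes the parallel gain tangent strictly below the loss branch
at `a`, so a `0`-pair lies to the right of `a`; this is impossible if `L ≤ a`. -/
theorem convex_middle_pair_lt (h : Market U D θ L ν lam) (hc : StrictConvexOn ℝ (Ici 0) D)
    (hlam : 0 < lam) (hno : ¬ ∃ a b, TangentPair U D θ ν 0 a b ∧ L < a) {a b : ℝ}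
    (hp : TangentPair U D θ ν lam a b) : a < L := by
  by_contra hLa
  obtain ⟨a', b', hp', ha'⟩ := exists_tangentPair_gt h.reward h.penalty hc
    (hp.nu_pos h.reward h.nu_nonneg) le_rfl hp.1 hp.2.1 hp.2.2.1 (by linarith [hp.mul_eq])
  exact hno ⟨a', b', hp', (not_lt.1 hLa).trans_lt ha'⟩

theorem convex_middle_pair (h : Market U D θ L ν lam) (hc : StrictConvexOn ℝ (Ici 0) D)
    (hL : L < θ) (hw : θ < w) {a b z : ℝ}
    (e : deriv U (w - θ) * (w - L) = U (w - θ) + ν * D (θ - L))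
    (hz : TangentLoss U D θ L ν lam z) (hzw : ν * deriv D (θ - z) ≤ deriv U (w - θ))
    (hp : TangentPair U D θ ν lam a b) (haL : a < L) (ha : 0 < a) :
    IsSolution (fNuLam U D θ L ν lam)
      [(gainPiece U θ, deriv U (b - θ)), (lossPiece D θ ν, ν * deriv D θ)] := by
  refine h.isSolution_pair hc hp ha.le haL (hL.trans hp.2.1).le fun _ => ?_
  have h1 := h.penalty.neg_le_tangent_shift hc h.nu_nonneg hp.1 (lt_min_iff.1 hz.2.1).2.le
  have h2 := h.reward.le_tangent_shift hp.2.1 hw.le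
  have h3 := hp.mul_eq
  rw [← hp.2.2.1] at h2 h3
  have := h.level_le_line hL hw e hz hzw (s := ν * deriv D (θ - a))
    (c := -(ν * D (θ - a)) - ν * deriv D (θ - a) * a) (by linarith) (by linarith)
  linarith

theorem convex_middle_pair_zero (h : Market U D θ L ν lam) (hc : StrictConvexOn ℝ (Ici 0) D)
    (hL : L < θ) (hw : θ < w) {z z' : ℝ}
    (e : deriv U (w - θ) * (w - L) = U (w - θ) + ν * D (θ - L))
    (hz : TangentLoss U D θ L ν lam z) (hzw : ν * deriv D (θ - z) ≤ deriv U (w - θ))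
    (hno : ¬ ∃ a b, TangentPair U D θ ν lam a b ∧ 0 < a) (hz' : TangentZero U D θ ν lam z') :
    IsSolution (fNuLam U D θ L ν lam) [(gainPiece U θ, deriv U (z' - θ))] := by
  have hs := h.deriv_theta_le hc h.lam_nonneg hz' hno
  refine h.isSolution_zero hz' (hL.trans hz'.1).le fun x hx hxθ =>
    h.loss_le_of_slope hc hs (fun _ => ?_) hx hxθ
  have h1 := h.penalty.neg_le_tangent_shift hc h.nu_nonneg h.theta_pos
    (lt_min_iff.1 hz.2.1).2.le
  rw [sub_zero, sub_zero] at h1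
  have h2 := h.reward.le_tangent_shift hz'.1 hw.le
  have h3 := hz'.mul_eq h.theta_pos
  refine h.level_le_line hL hw e hz hzw ?_ ?_
  · nlinarith [mul_nonneg (sub_nonneg.2 hs) hz.1]
  · linarith

end Middle

theorem convex_eq_pair (h : Market U D θ L ν lam) (hc : StrictConvexOn ℝ (Ici 0) D)
    (hL : L = θ) {a b : ℝ} (hp : TangentPair U D θ ν lam a b) (ha : 0 < a) :
    IsSolution (fNuLam U D θ L ν lam)
      [(gainPiece U θ, deriv U (b - θ)), (lossPiece D θ ν, ν * deriv D θ)] :=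
  h.isSolution_pair hc hp ha.le (hL ▸ hp.1) (hL ▸ hp.2.1.le) fun hlt => absurd hL hlt.ne

theorem convex_eq_zero (h : Market U D θ L ν lam) (hc : StrictConvexOn ℝ (Ici 0) D)
    (hL : L = θ) {z : ℝ} (hno : ¬ ∃ a b, TangentPair U D θ ν lam a b ∧ 0 < a)
    (hz : TangentZero U D θ ν lam z) :
    IsSolution (fNuLam U D θ L ν lam) [(gainPiece U θ, deriv U (z - θ))] :=
  h.isSolution_zero hz (hL ▸ hz.1.le) fun _ hx hxθ =>
    h.loss_le_of_slope hc (h.deriv_theta_le hc h.lam_nonneg hz hno)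
      (fun hlt => absurd hL hlt.ne) hx hxθ

/-! ### Strictly convex penalty, level above the threshold. -/

section High

variable {w : ℝ}

theorem gain_le_level_line (h : Market U D θ L ν lam) (hL : θ < L) (hw : θ < w)
    (e : deriv U (w - θ) * (L - w) = U (L - θ) + lam - U (w - θ)) {s : ℝ}
    (hs : s ≤ deriv U (w - θ)) {x : ℝ} (hx : θ ≤ x) (hxL : x < L) :
    U (x - θ) ≤ fNuLam U D θ L ν lam L + s * (x - L) := by
  have h1 := h.reward.le_tangent_shift hw hx
  rw [h.gain_ge hL.le le_rfl]
  nlinarith [mul_nonneg (sub_nonneg.2 hs) (sub_pos.2 hxL).le]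

theorem convex_high_level_zero (h : Market U D θ L ν lam) (hc : StrictConvexOn ℝ (Ici 0) D)
    {k : ℝ} (hk : k = kSlope U D θ L ν lam) (hL : θ < L) (hw : θ < w)
    (e : deriv U (w - θ) * (L - w) = U (L - θ) + lam - U (w - θ))
    (hδk : ν * deriv D θ < k) (hkw : k < deriv U (w - θ)) (hLk : deriv U (L - θ) ≤ k) :
    IsSolution (fNuLam U D θ L ν lam) [(gainPiece U θ, deriv U (L - θ)), (fun _ => L, k)] := by
  have hx : ∀ x, 0 ≤ x → x < L →
      fNuLam U D θ L ν lam x ≤ fNuLam U D θ L ν lam L + k * (x - L) := by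
    intro x hx hxL
    rcases le_total x θ with hxθ | hxθ
    · exact h.le_level_line hc hk hδk.le hx hxθ hxL
    · rw [h.gain_lt hxθ hxL]
      exact h.gain_le_level_line hL hw e hkw.le hxθ hxL
  refine h.isSolution_level_gt hL (fun x hx0 hxL => ?_) fun hdom =>
    h.level_tail_zero hk hLk hdom hx
  have := hx x hx0 hxL
  nlinarith [mul_nonneg (sub_nonneg.2 hLk) (sub_pos.2 hxL).le]

/-- Since `k < U'(L - θ)`, the raised gain tangent at `L` meets the vertical axis below the origin's
value, so the contact point must move right. -/
theorem level_lt_tangentZero (h : Market U D θ L ν lam) {k z : ℝ}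
    (hk : k = kSlope U D θ L ν lam) (hL : θ < L) (hkL : k < deriv U (L - θ))
    (hz : TangentZero U D θ ν lam z) : L < z := by
  have ez := hz.mul_eq h.theta_pos
  have h2 := h.kSlope_mul
  rw [← hk, h.gain_ge hL.le le_rfl] at h2
  refine h.reward.lt_of_tangentGap_lt h.theta_pos.le hz.1 ?_
  linarith [mul_lt_mul_of_pos_right hkL h.level_pos]

theorem convex_high_zero (h : Market U D θ L ν lam) (hc : StrictConvexOn ℝ (Ici 0) D)
    {k z : ℝ} (hk : k = kSlope U D θ L ν lam) (hL : θ < L) (hδk : ν * deriv D θ < k)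
    (hLz : L < z) (hz : TangentZero U D θ ν lam z) :
    IsSolution (fNuLam U D θ L ν lam) [(gainPiece U θ, deriv U (z - θ))] := by
  have ez := hz.mul_eq h.theta_pos
  have h2 := h.kSlope_mul
  rw [← hk, h.gain_ge hL.le le_rfl] at h2
  have h3 := h.reward.le_tangent_shift hz.1 hL.le
  have hkz : k ≤ deriv U (z - θ) := le_of_mul_le_mul_right (by linarith) h.level_pos
  exact h.isSolution_zero hz hLz.le fun x hx hxθ =>
    h.loss_le_of_slope hc (hδk.le.trans hkz) (fun hlt => absurd hlt hL.le.not_gt) hx hxθ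

/-- The tangent at `w` passes through the jump point and is no steeper than the chord to the origin,
so at `0` it is not below `f 0`. For the second claim, the tangent at `z` is the steeper of the two
and passes above the jump point. -/
theorem tangentZero_le_levelTangent (h : Market U D θ L ν lam) {k z : ℝ}
    (hk : k = kSlope U D θ L ν lam) (hw : θ < w) (hwL : w ≤ L)
    (e : deriv U (w - θ) * (L - w) = U (L - θ) + lam - U (w - θ))
    (hwk : deriv U (w - θ) ≤ k) (hz : TangentZero U D θ ν 0 z) :
    z ≤ w ∧ k ≤ deriv U (z - θ) := by
  have ez := hz.mul_eq h.theta_pos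
  have h2 := h.kSlope_mul
  rw [← hk, h.gain_ge (hw.le.trans hwL) le_rfl] at h2
  have hzw : z ≤ w := by
    refine h.reward.le_of_tangentGap_le h.theta_pos.le hw ?_
    linarith [mul_le_mul_of_nonneg_right hwk h.level_pos.le]
  refine ⟨hzw, ?_⟩
  by_contra hlt
  have h3 := h.reward.le_tangent_shift hz.1 hw.le
  have h4 := (h.reward.deriv_shift_le_iff hw hz.1).2 hzw
  have h5 := mul_lt_mul_of_pos_right (not_le.1 hlt) h.level_pos
  nlinarith [mul_nonneg (sub_nonneg.2 h4) (sub_nonneg.2 hwL)]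

theorem convex_high_level_gain_zero (h : Market U D θ L ν lam) (hc : StrictConvexOn ℝ (Ici 0) D)
    {z : ℝ} (hwL : w < L) (e : deriv U (w - θ) * (L - w) = U (L - θ) + lam - U (w - θ))
    (hz : TangentZero U D θ ν 0 z) (hzw : z ≤ w) (hδz : ν * deriv D θ ≤ deriv U (z - θ)) :
    IsSolution (fNuLam U D θ L ν lam) [(gainPiece U θ, deriv U (L - θ)),
      (fun _ => L, deriv U (w - θ)), (gainPiece U θ, deriv U (z - θ))] := by
  refine h.isSolution_level_levelTangent_zero hz hzw hwL.le e fun x hx hxθ => ?_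
  have h1 := h.penalty.neg_le_tangent_shift hc h.nu_nonneg h.theta_pos hxθ.le
  rw [sub_zero, sub_zero] at h1
  linarith [mul_le_mul_of_nonneg_right hδz hx]

theorem convex_high_level_loss (h : Market U D θ L ν lam) (hc : StrictConvexOn ℝ (Ici 0) D)
    {z : ℝ} (hν : 0 < ν) (hL : θ < L) (hw : θ < w)
    (e : deriv U (w - θ) * (L - w) = U (L - θ) + lam - U (w - θ))
    (hz : TangentLoss U D θ L ν lam z) (hzw : ν * deriv D (θ - z) ≤ deriv U (w - θ))
    (hLz : deriv U (L - θ) ≤ ν * deriv D (θ - z)) :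
    IsSolution (fNuLam U D θ L ν lam) [(gainPiece U θ, deriv U (L - θ)),
      (fun _ => L, ν * deriv D (θ - z)), (lossPiece D θ ν, ν * deriv D θ)] := by
  have ez := hz.mul_eq
  refine h.isSolution_level_gt hL (fun x hx hxL => ?_) fun hdom =>
    h.level_tail_loss hc hν hz hLz hdom fun x hx hxL => h.gain_le_level_line hL hw e hzw hx hxL
  rcases le_total x θ with hxθ | hxθ
  · have h1 := h.penalty.neg_le_tangent_shift hc hν.le (lt_min_iff.1 hz.2.1).2 hxθ
    rw [h.loss_lt hxθ hxL]
    nlinarith [mul_nonneg (sub_nonneg.2 hLz) (sub_pos.2 hxL).le]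
  · rw [h.gain_lt hxθ hxL]
    exact h.gain_le_level_line hL hw e (hLz.trans hzw) hxθ hxL

/-- If no point of the loss branch has a tangent through the jump point, then the loss branch is
steeper than the tangent to the gain branch through the jump point. -/
theorem levelTangent_lt_of_no_tangentLoss (h : Market U D θ L ν lam)
    (hc : StrictConvexOn ℝ (Ici 0) D) (hlam : 0 < lam)
    (hk : kSlope U D θ L ν lam ≤ ν * deriv D θ) (hL : θ < L) (hw : θ < w)
    (e : deriv U (w - θ) * (L - w) = U (L - θ) + lam - U (w - θ))
    (hno : ¬ ∃ z, TangentLoss U D θ L ν lam z) {a : ℝ} (ha : a < θ) :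
    deriv U (w - θ) < ν * deriv D (θ - a) := by
  have hν := h.nu_pos hlam hk
  have hfL := h.gain_ge hL.le le_rfl
  have hpos := mul_pos hν (h.penalty.deriv_pos hc (sub_pos.2 ha))
  have h0 : U (θ - θ) < U (w - θ) + deriv U (w - θ) * (θ - w) :=
    h.reward.lt_tangent_shift hw le_rfl hw.ne
  rw [sub_self, h.reward.map_zero] at h0
  refine lt_of_mul_lt_mul_right (a := L - θ) ?_ (sub_pos.2 hL).le
  refine lt_of_lt_of_le (b := fNuLam U D θ L ν lam L) (by linarith) ?_
  -- Without a tangent point, every loss tangent passes above the jump point. Taking the contact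
  -- point `θ - t` close to `θ` costs at most `ε`.
  refine le_of_forall_pos_lt_add fun ε hε => ?_
  obtain ⟨t, ht⟩ : ∃ t, t = min (min (θ - a) θ) (ε / (ν * deriv D (θ - a))) := ⟨_, rfl⟩
  have ht0 : 0 < t := by
    rw [ht]; exact lt_min (lt_min (sub_pos.2 ha) h.theta_pos) (div_pos hε hpos)
  have ht1 : t ≤ θ - a := ht ▸ (min_le_left _ _).trans (min_le_left _ _)
  have ht2 : t ≤ θ := ht ▸ (min_le_left _ _).trans (min_le_right _ _)
  have ht3 : ν * deriv D (θ - a) * t ≤ ε := by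
    have : t ≤ ε / (ν * deriv D (θ - a)) := ht ▸ min_le_right _ _
    rwa [le_div_iff₀ hpos, mul_comm] at this
  have h1 : fNuLam U D θ L ν lam L <
      ν * deriv D (θ - (θ - t)) * (L - (θ - t)) - ν * D (θ - (θ - t)) := by
    by_contra hle
    exact hno (h.exists_tangentLoss hlam hk (by linarith) (by linarith) (by linarith)
      (not_lt.1 hle))
  have h2 := h.penalty.deriv_shift_le hc hν.le (show a ≤ θ - t by linarith)
    (show θ - t < θ by linarith)
  have h3 := mul_nonneg hν.le (h.penalty.nonneg (show 0 ≤ θ - (θ - t) by linarith))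
  nlinarith [mul_le_mul_of_nonneg_right h2 (show 0 ≤ L - (θ - t) by linarith)]

theorem pair_lt_levelTangent (h : Market U D θ L ν lam) (hc : StrictConvexOn ℝ (Ici 0) D)
    (hlam : 0 < lam) (hk : kSlope U D θ L ν lam ≤ ν * deriv D θ) (hL : θ < L) (hw : θ < w)
    (e : deriv U (w - θ) * (L - w) = U (L - θ) + lam - U (w - θ))
    (hz : ∀ z, TangentLoss U D θ L ν lam z → deriv U (w - θ) < ν * deriv D (θ - z)) {a b : ℝ}
    (hp : TangentPair U D θ ν 0 a b) : b < w := by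
  have hν := h.nu_pos hlam hk
  rw [← h.reward.deriv_shift_lt_iff hw hp.2.1, ← hp.2.2.1]
  by_cases hex : ∃ z, TangentLoss U D θ L ν lam z
  · obtain ⟨z, htz⟩ := hex
    have hwz := hz z htz
    have ez := htz.mul_eq
    have hzθ := (lt_min_iff.1 htz.2.1).2
    rw [h.gain_ge hL.le le_rfl] at ez
    by_contra hlt
    have hlt := not_lt.1 hlt
    have h1 := h.reward.le_tangent_shift hp.2.1 hw.le
    have h2 := h.penalty.neg_le_tangent_shift hc hν.le hzθ hp.1.le
    have h3 := hp.mul_eq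
    rw [← hp.2.2.1] at h1 h3
    have haw := hp.1.trans hw
    -- The pair's line is strictly below the level tangent at `a` (where the loss tangent at `z`
    -- bounds it) but not below it at `w`, so it must be steeper.
    nlinarith [mul_nonneg (sub_nonneg.2 hlt) (sub_pos.2 haw).le,
      mul_pos (sub_pos.2 hwz) (sub_pos.2 (hp.1.trans hL))]
  · exact h.levelTangent_lt_of_no_tangentLoss hc hlam hk hL hw e hex hp.1

theorem convex_high_level_gain_pair (h : Market U D θ L ν lam) (hc : StrictConvexOn ℝ (Ici 0) D)
    {a b : ℝ} (hwL : w < L)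
    (e : deriv U (w - θ) * (L - w) = U (L - θ) + lam - U (w - θ))
    (hp : TangentPair U D θ ν 0 a b) (hbw : b < w) (ha : 0 ≤ a) :
    IsSolution (fNuLam U D θ L ν lam) [(gainPiece U θ, deriv U (L - θ)),
      (fun _ => L, deriv U (w - θ)), (gainPiece U θ, deriv U (b - θ)),
      (lossPiece D θ ν, ν * deriv D θ)] := by
  have hν := hp.nu_pos h.reward h.nu_nonneg
  have e' := hp.mul_eq
  obtain ⟨haθ, hb, hs, -⟩ := hp
  have haL : a < L := by linarith
  refine h.isSolution_level_levelTangent hb hbw.le hwL.le e (fun x hx hxθ => ?_) fun hdom => ?_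
  · have h1 := h.penalty.neg_le_tangent_shift hc hν.le haθ hxθ.le
    rw [hs] at h1
    linarith
  · have hdoma := hdom.of_touch (q := a) ha (by
      rw [h.loss_lt haθ.le haL, h.gain_lt hb.le (hbw.trans hwL)]
      linarith)
    rw [← hs] at hdoma ⊢
    exact h.loss_tail hc hν ha haθ haL hdoma

theorem tangentZero_le_of_tangentLoss (h : Market U D θ L ν lam) (hc : StrictConvexOn ℝ (Ici 0) D)
    (hlam : 0 < lam) (hk : kSlope U D θ L ν lam ≤ ν * deriv D θ) (hL : θ < L) (hw : θ < w)
    (e : deriv U (w - θ) * (L - w) = U (L - θ) + lam - U (w - θ))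
    (hz : ∀ z, TangentLoss U D θ L ν lam z → deriv U (w - θ) < ν * deriv D (θ - z)) {z : ℝ}
    (hz' : TangentZero U D θ ν 0 z) (hδz : ν * deriv D θ ≤ deriv U (z - θ)) : z ≤ w := by
  rw [← h.reward.deriv_shift_le_iff hw hz'.1]
  refine le_trans (le_of_lt ?_) hδz
  by_cases hex : ∃ z, TangentLoss U D θ L ν lam z
  · obtain ⟨y, hy⟩ := hex
    have h1 := h.penalty.deriv_shift_le hc h.nu_nonneg hy.1 (lt_min_iff.1 hy.2.1).2
    rw [sub_zero] at h1
    exact (hz y hy).trans_le h1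
  · have := h.levelTangent_lt_of_no_tangentLoss hc hlam hk hL hw e hex h.theta_pos
    rwa [sub_zero] at this

/-- A steeper line above the point `z` of the loss branch that is tangent to the gain branch is
tangent to it beyond the level. -/
theorem level_lt_of_tangentLoss (h : Market U D θ L ν lam) (hL : θ < L) {z b c : ℝ}
    (hz : TangentLoss U D θ L ν lam z) (hzL : ν * deriv D (θ - z) < deriv U (L - θ)) (hb : θ < b)
    (h1 : -(ν * D (θ - z)) ≤ c + deriv U (b - θ) * z)
    (h2 : U (b - θ) + lam = c + deriv U (b - θ) * b) : L < b := by
  by_contra hbL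
  have hbL := not_lt.1 hbL
  have h3 := (h.reward.deriv_shift_le_iff hL hb).2 hbL
  have h4 := h.reward.le_tangent_shift hL hb.le
  have ez := hz.mul_eq
  have hzθ := (lt_min_iff.1 hz.2.1).2
  rw [h.gain_ge hL.le le_rfl] at ez
  -- If `b ≤ L`, the raised gain branch at `b` is not above the loss tangent at `z`, while the given
  -- line, starting from `z` at least as high and steeper, is strictly above it at `b`.
  nlinarith [mul_nonneg (sub_pos.2 hzL).le (sub_nonneg.2 hbL),
    mul_pos (sub_pos.2 (hzL.trans_le h3)) (sub_pos.2 (hzθ.trans hb))]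

theorem convex_high_pair_gt (h : Market U D θ L ν lam) (hc : StrictConvexOn ℝ (Ici 0) D)
    (hL : θ < L) {z a b : ℝ} (hz : TangentLoss U D θ L ν lam z)
    (hzL : ν * deriv D (θ - z) < deriv U (L - θ)) (hp : TangentPair U D θ ν lam a b) :
    L < b := by
  have h1 := h.penalty.neg_le_tangent_shift hc h.nu_nonneg hp.1 (lt_min_iff.1 hz.2.1).2.le
  rw [hp.2.2.1] at h1
  exact h.level_lt_of_tangentLoss hL hz hzL hp.2.1
    (c := -(ν * D (θ - a)) - deriv U (b - θ) * a) (by linarith) (by linarith [hp.mul_eq])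

theorem convex_high_pair (h : Market U D θ L ν lam) (hc : StrictConvexOn ℝ (Ici 0) D)
    (hL : θ < L) {a b : ℝ} (hp : TangentPair U D θ ν lam a b) (hLb : L < b) (ha : 0 < a) :
    IsSolution (fNuLam U D θ L ν lam)
      [(gainPiece U θ, deriv U (b - θ)), (lossPiece D θ ν, ν * deriv D θ)] :=
  h.isSolution_pair hc hp ha.le (hp.1.trans hL) hLb.le fun hlt => absurd hlt hL.le.not_gt

theorem convex_high_pair_zero (h : Market U D θ L ν lam) (hc : StrictConvexOn ℝ (Ici 0) D)
    (hL : θ < L) {z z' : ℝ} (hz : TangentLoss U D θ L ν lam z)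
    (hzL : ν * deriv D (θ - z) < deriv U (L - θ))
    (hno : ¬ ∃ a b, TangentPair U D θ ν lam a b ∧ 0 < a) (hz' : TangentZero U D θ ν lam z') :
    L < z' ∧ IsSolution (fNuLam U D θ L ν lam) [(gainPiece U θ, deriv U (z' - θ))] := by
  have hs := h.deriv_theta_le hc h.lam_nonneg hz' hno
  have h1 := h.penalty.neg_le_tangent_shift hc h.nu_nonneg h.theta_pos
    (lt_min_iff.1 hz.2.1).2.le
  rw [sub_zero, sub_zero] at h1
  have hLz : L < z' := h.level_lt_of_tangentLoss hL hz hzL hz'.1 (c := -(ν * D θ))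
    (by linarith [mul_le_mul_of_nonneg_right hs hz.1])
    (by linarith [hz'.mul_eq h.theta_pos])
  exact ⟨hLz, h.isSolution_zero hz' hLz.le fun x hx hxθ =>
    h.loss_le_of_slope hc hs (fun hlt => absurd hlt hL.le.not_gt) hx hxθ⟩

end High

end Convex

/-! ### Concave penalty -/

section Concave

/-- A line above the end points of an arc of the convex loss branch lies above the arc. -/
theorem loss_le_line (h : Market U D θ L ν lam) (hc : ConcaveOn ℝ (Ici 0) D) {a b c s x : ℝ}
    (hb : b ≤ θ) (hax : a ≤ x) (hxb : x ≤ b) (h1 : -(ν * D (θ - a)) ≤ c + s * a)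
    (h2 : -(ν * D (θ - b)) ≤ c + s * b) : -(ν * D (θ - x)) ≤ c + s * x := by
  rcases (hax.trans hxb).eq_or_lt with rfl | hab
  · obtain rfl : x = a := le_antisymm hxb hax
    exact h1
  have h3 := mul_le_mul_of_nonneg_left (chord_le_of_concaveOn hc (sub_nonneg.2 hb)
    (sub_le_sub_left hxb θ) (sub_le_sub_left hax θ)) h.nu_nonneg
  have h4 := mul_le_mul_of_nonneg_left h1 (sub_nonneg.2 hxb)
  have h5 := mul_le_mul_of_nonneg_left h2 (sub_nonneg.2 hax)
  refine le_of_mul_le_mul_left ?_ (sub_pos.2 hab)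
  linarith

theorem loss_le_tangentZero (h : Market U D θ L ν lam) (hc : ConcaveOn ℝ (Ici 0) D) {μ z x : ℝ}
    (hμ : 0 ≤ μ) (hz : TangentZero U D θ ν μ z) (hx : 0 ≤ x) (hxθ : x ≤ θ) :
    -(ν * D (θ - x)) ≤ -(ν * D θ) + deriv U (z - θ) * x := by
  refine h.loss_le_line hc le_rfl hx hxθ (by simp) ?_
  have h1 := h.reward.le_tangent_shift hz.1 le_rfl
  have h2 := hz.mul_eq h.theta_pos
  rw [sub_self, h.reward.map_zero] at h1
  rw [sub_self, h.penalty.map_zero]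
  linarith

theorem le_tangentZero_of_lt (h : Market U D θ L ν lam) (hc : ConcaveOn ℝ (Ici 0) D) {z x : ℝ}
    (hz : TangentZero U D θ ν 0 z) (hx : 0 ≤ x) (hxL : x < L) :
    fNuLam U D θ L ν lam x ≤ -(ν * D θ) + deriv U (z - θ) * x := by
  rcases le_total x θ with hxθ | hxθ
  · rw [h.loss_lt hxθ hxL]
    exact h.loss_le_tangentZero hc le_rfl hz hx hxθ
  · rw [h.gain_lt hxθ hxL]
    linarith [h.reward.le_tangent_shift hz.1 hxθ, hz.mul_eq h.theta_pos]

theorem level_line_eq (h : Market U D θ L ν lam) (x : ℝ) :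
    fNuLam U D θ L ν lam L + kSlope U D θ L ν lam * (x - L) =
      -(ν * D θ) + kSlope U D θ L ν lam * x := by
  linarith [h.kSlope_mul]

theorem deriv_level_le_kSlope (h : Market U D θ L ν lam) {z : ℝ}
    (hz : TangentZero U D θ ν 0 z) (hzL : z ≤ L) :
    deriv U (L - θ) ≤ kSlope U D θ L ν lam := by
  have hθL := hz.1.trans_le hzL
  have h1 := h.kSlope_mul
  have h2 := hz.mul_eq h.theta_pos
  rw [h.gain_ge hθL.le le_rfl] at h1
  refine le_of_mul_le_mul_right ?_ h.level_pos
  rcases hzL.eq_or_lt with rfl | hlt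
  · linarith [h.lam_nonneg]
  · linarith [h.lam_nonneg, h.reward.tangentGap_shift_lt h.theta_pos.le hz.1 hlt]

theorem isSolution_level_zero (h : Market U D θ L ν lam) (hL : θ < L)
    (hk : deriv U (L - θ) ≤ kSlope U D θ L ν lam)
    (hx : ∀ x, 0 ≤ x → x < L →
      fNuLam U D θ L ν lam x ≤ -(ν * D θ) + kSlope U D θ L ν lam * x) :
    IsSolution (fNuLam U D θ L ν lam)
      [(gainPiece U θ, deriv U (L - θ)), (fun _ => L, kSlope U D θ L ν lam)] := by
  have hx' : ∀ x, 0 ≤ x → x < L → fNuLam U D θ L ν lam x ≤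
      fNuLam U D θ L ν lam L + kSlope U D θ L ν lam * (x - L) := fun x hx0 hxL => by
    rw [h.level_line_eq]
    exact hx x hx0 hxL
  refine h.isSolution_level_gt hL (fun x hx0 hxL => ?_) fun hdom =>
    h.level_tail_zero rfl hk hdom hx'
  nlinarith [hx' x hx0 hxL, mul_nonneg (sub_nonneg.2 hk) (sub_pos.2 hxL).le]

theorem concave_high (h : Market U D θ L ν lam) (hc : ConcaveOn ℝ (Ici 0) D) {z : ℝ}
    (hz : TangentZero U D θ ν 0 z) (hzL : z ≤ L)
    (hk : deriv U (z - θ) < kSlope U D θ L ν lam) :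
    IsSolution (fNuLam U D θ L ν lam)
      [(gainPiece U θ, deriv U (L - θ)), (fun _ => L, kSlope U D θ L ν lam)] :=
  h.isSolution_level_zero (hz.1.trans_le hzL) (h.deriv_level_le_kSlope hz hzL) fun x hx hxL =>
    (h.le_tangentZero_of_lt hc hz hx hxL).trans
      (by linarith [mul_le_mul_of_nonneg_right hk.le hx])

theorem concave_existsUnique_levelTangent (h : Market U D θ L ν lam) {z : ℝ}
    (hz : TangentZero U D θ ν 0 z) (hzL : z ≤ L)
    (hk : kSlope U D θ L ν lam ≤ deriv U (z - θ)) :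
    ∃! w, z ≤ w ∧ w ≤ L ∧
      U (L - θ) + lam - U (w - θ) = (L - w) * deriv U (w - θ) := by
  have hU := h.reward
  have hθL := hz.1.trans_le hzL
  have h1 := h.kSlope_mul
  have h2 := hz.mul_eq h.theta_pos
  rw [h.gain_ge hθL.le le_rfl] at h1
  have h3 := mul_le_mul_of_nonneg_right hk h.level_pos.le
  obtain ⟨x, hx1, hx2, hx⟩ := hU.exists_chordGap_eq (M := L - θ) (t := U (L - θ) + lam)
    (sub_pos.2 hz.1) (by linarith) (by linarith [h.lam_nonneg]) (by linarith)
  have hx0 := (sub_pos.2 hz.1).trans_le hx1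
  refine ⟨x + θ, ⟨by linarith, by linarith, ?_⟩, ?_⟩
  · rw [add_sub_cancel_right]
    linarith
  · rintro y ⟨hy1, hy2, hy⟩
    by_contra hne
    rcases lt_or_gt_of_ne (show y - θ ≠ x by intro h; apply hne; linarith) with hlt | hlt
    · linarith [hU.chordGap_lt (sub_pos.2 (hz.1.trans_le hy1)) hlt hx2]
    · linarith [hU.chordGap_lt hx0 hlt (show y - θ ≤ L - θ by linarith)]

theorem concave_middle_level (h : Market U D θ L ν lam) (hc : ConcaveOn ℝ (Ici 0) D) {z : ℝ}
    (hz : TangentZero U D θ ν 0 z) (hL : θ < L) (hLz : L < z)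
    (hk : deriv U (L - θ) ≤ kSlope U D θ L ν lam) :
    IsSolution (fNuLam U D θ L ν lam)
      [(gainPiece U θ, deriv U (L - θ)), (fun _ => L, kSlope U D θ L ν lam)] := by
  have h1 := h.kSlope_mul
  have h2 := hz.mul_eq h.theta_pos
  have h3 := h.reward.tangentGap_shift_lt h.theta_pos.le hL hLz
  have h4 := h.reward.deriv_pos (sub_pos.2 hL)
  rw [h.gain_ge hL.le le_rfl] at h1
  have hgain : ∀ x, θ ≤ x → x ≤ L →
      U (x - θ) ≤ -(ν * D θ) + kSlope U D θ L ν lam * x := by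
    intro x hx hxL
    have h5 := h.reward.le_tangent_shift hL hx
    have hx0 := h.theta_pos.le.trans hx
    refine le_of_mul_le_mul_right ?_ h.level_pos
    -- The chord from the origin to the jump point is above the gain tangent at `L` at both ends: at
    -- `0` because `L < z`, at `L` because `λ ≥ 0`.
    nlinarith [mul_le_mul_of_nonneg_right h5 h.level_pos.le, mul_nonneg h.lam_nonneg hx0,
      mul_nonneg (sub_nonneg.2 hxL) (sub_nonneg.2 h3.le)]
  refine h.isSolution_level_zero hL hk fun x hx hxL => ?_
  rcases le_total x θ with hxθ | hxθ
  · rw [h.loss_lt hxθ hxL]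
    refine h.loss_le_line hc le_rfl hx hxθ (by simp) ?_
    have := hgain θ le_rfl hL.le
    rw [sub_self, h.reward.map_zero] at this
    rwa [sub_self, h.penalty.map_zero, mul_zero, neg_zero]
  · rw [h.gain_lt hxθ hxL]
    exact hgain x hxθ hxL.le

theorem tangentZero_iff_mul (h : Market U D θ L ν lam) {μ z : ℝ} :
    TangentZero U D θ ν μ z ↔ θ < z ∧ U (z - θ) + μ + ν * D θ = z * deriv U (z - θ) := by
  rw [tangentZero_iff h.theta_pos]
  refine and_congr_right fun _ => ⟨fun h => by linarith, fun h => by linarith⟩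

theorem existsUnique_tangentZero (h : Market U D θ L ν lam) {μ : ℝ} (hμ : 0 ≤ μ) :
    ∃! z, TangentZero U D θ ν μ z := by
  simp only [tangentZero_iff h.theta_pos]
  exact h.reward.existsUnique_tangent h.theta_pos
    (add_nonneg hμ (mul_nonneg h.nu_nonneg (h.penalty.nonneg h.theta_pos.le)))

theorem tangentZero_anti (h : Market U D θ L ν lam) {z z' : ℝ}
    (hz : TangentZero U D θ ν 0 z) (hz' : TangentZero U D θ ν lam z') : z' ≤ z := by
  refine h.reward.le_of_tangentGap_le h.theta_pos.le hz.1 ?_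
  linarith [hz.mul_eq h.theta_pos, hz'.mul_eq h.theta_pos, h.lam_nonneg]

theorem concave_isSolution_zero (h : Market U D θ L ν lam) (hc : ConcaveOn ℝ (Ici 0) D)
    (hL : θ ≤ L) {z : ℝ} (hz : TangentZero U D θ ν lam z) (hLz : L ≤ z) :
    IsSolution (fNuLam U D θ L ν lam) [(gainPiece U θ, deriv U (z - θ))] :=
  h.isSolution_zero hz hLz fun x hx hxθ => by
    rw [h.loss_lt hxθ.le (hxθ.trans_le hL)]
    exact h.loss_le_tangentZero hc h.lam_nonneg hz hx hxθ.le

theorem existsUnique_tangent_level (h : Market U D θ L ν lam) (hL : L < θ) :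
    ∃! w, θ < w ∧ deriv U (w - θ) * (w - L) = U (w - θ) + ν * D (θ - L) :=
  h.reward.existsUnique_tangent hL
    (mul_nonneg h.nu_nonneg (h.penalty.nonneg (sub_pos.2 hL).le))

/-- At `L` the loss branch is below its chord over `[0, θ]`, and that chord, of slope `s`, is below
the tangent at `z`. Thus the tangent at `w` is lower at `L` than the one at `z`. -/
theorem concave_tangent_level_lt (h : Market U D θ L ν lam) (hc : ConcaveOn ℝ (Ici 0) D)
    (hL : L < θ) {w z : ℝ} (hz : TangentZero U D θ ν 0 z)
    (e : deriv U (w - θ) * (w - L) = U (w - θ) + ν * D (θ - L)) : w < z := by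
  refine h.reward.lt_of_tangentGap_lt hL.le hz.1 ?_
  have h1 := h.reward.lt_tangent_shift hz.1 le_rfl hz.1.ne
  have h2 := hz.mul_eq h.theta_pos
  rw [sub_self, h.reward.map_zero] at h1
  obtain ⟨s, hs1, hs2⟩ : ∃ s, s * θ = ν * D θ ∧ s < deriv U (z - θ) := by
    refine ⟨ν * D θ / θ, div_mul_cancel₀ _ h.theta_pos.ne', ?_⟩
    rw [div_lt_iff₀ h.theta_pos]
    linarith
  have h3 := h.loss_le_line hc le_rfl h.level_pos.le hL.le (c := -(ν * D θ)) (s := s)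
    (by simp) (by rw [sub_self, h.penalty.map_zero]; linarith)
  linarith [mul_lt_mul_of_pos_right hs2 h.level_pos]

theorem concave_low_level (h : Market U D θ L ν lam) (hc : ConcaveOn ℝ (Ici 0) D)
    (hL : L < θ) {w : ℝ} (hw : θ < w)
    (e : deriv U (w - θ) * (w - L) = U (w - θ) + ν * D (θ - L))
    (hk : deriv U (w - θ) < kSlope U D θ L ν lam) :
    IsSolution (fNuLam U D θ L ν lam)
      [(gainPiece U θ, deriv U (w - θ)), (fun _ => L, kSlope U D θ L ν lam)] := by
  have hfL := h.loss_ge hL.le le_rfl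
  have h1 := h.kSlope_mul
  have hx' : ∀ x, 0 ≤ x → x < L → fNuLam U D θ L ν lam x ≤
      fNuLam U D θ L ν lam L + kSlope U D θ L ν lam * (x - L) := fun x hx hxL => by
    rw [h.level_line_eq, h.loss_lt (hxL.trans hL).le hxL]
    exact h.loss_le_line hc hL.le hx hxL.le (by simp) (by linarith [h.lam_nonneg])
  refine h.isSolution_level_lt hL hw e (fun x hLx hxθ => ?_) (fun x hx hxL => ?_) fun hdom =>
    h.level_tail_zero rfl hk.le hdom hx'
  · have h2 := h.reward.le_tangent_shift hw le_rfl
    rw [sub_self, h.reward.map_zero] at h2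
    have := h.loss_le_line hc le_rfl hLx hxθ.le (s := deriv U (w - θ))
      (c := -(ν * D (θ - L)) - deriv U (w - θ) * L) (by linarith)
      (by rw [sub_self, h.penalty.map_zero]; linarith)
    rw [h.loss_ge hxθ.le hLx, hfL]
    linarith
  · nlinarith [hx' x hx hxL, mul_nonneg (sub_pos.2 hk).le (sub_pos.2 hxL).le]

theorem concave_low_zero (h : Market U D θ L ν lam) (hc : ConcaveOn ℝ (Ici 0) D)
    (hL : L < θ) {w z : ℝ} (hw : θ < w)
    (e : deriv U (w - θ) * (w - L) = U (w - θ) + ν * D (θ - L))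
    (hk : kSlope U D θ L ν lam ≤ deriv U (w - θ)) (hz : TangentZero U D θ ν lam z) :
    IsSolution (fNuLam U D θ L ν lam) [(gainPiece U θ, deriv U (z - θ))] := by
  have hkz := (h.kSlope_le_of_le_tangent rfl hL hw e hk hz).2
  have hfL := h.loss_ge hL.le le_rfl
  have h1 := h.kSlope_mul
  have h2 := mul_le_mul_of_nonneg_right hkz h.level_pos.le
  have h3 := hz.mul_eq h.theta_pos
  have h4 := h.reward.le_tangent_shift hz.1 le_rfl
  rw [sub_self, h.reward.map_zero] at h4
  refine h.isSolution_zero hz (hL.trans hz.1).le fun x hx hxθ => ?_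
  rcases lt_or_ge x L with hxL | hxL
  · rw [h.loss_lt hxθ.le hxL]
    exact h.loss_le_line hc hL.le hx hxL.le (by simp) (by linarith [h.lam_nonneg])
  -- Beyond the level the loss branch is raised by `λ`, so the line is lowered by `λ` instead.
  · have := h.loss_le_line hc le_rfl hxL hxθ.le (s := deriv U (z - θ))
      (c := -(ν * D θ) - lam) (by linarith)
      (by rw [sub_self, h.penalty.map_zero]; linarith)
    rw [h.loss_ge hxθ.le hxL]
    linarith

end Concave

end Market

end RatioVaR

open RatioVaR in
theorem mainTheorem1 (U D : ℝ → ℝ) (θ L ν lam : ℝ)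
    (hU : IsReward U) (hD : IsPenalty D)
    (hθ : 0 < θ) (hL : 0 < L) (hν : 0 ≤ ν) (hlam : 0 ≤ lam)
    (f : ℝ → ℝ) (hf : f = fNuLam U D θ L ν lam)
    (k : ℝ) (hk : k = kSlope U D θ L ν lam)
    (G : ℝ → ℝ) (hG : G = gainPiece U θ)
    (H : ℝ → ℝ) (hH : H = lossPiece D θ ν)
    (C : ℝ → ℝ) (hC : C = fun _ => L) :
    -- tangency from the origin (used for `z'`, `z₅`, `z₉`, `z₁₀` and for `z`)
    (∀ μ, 0 ≤ μ → ∃! z, TangentZero U D θ ν μ z) ∧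
    -- strictly convex penalty
    (StrictConvexOn ℝ (Ici 0) D →
      -- tangency pairs: at most one; one exists when `ν > 0` and `D'(∞) = ∞`
      (∀ μ, 0 ≤ μ →
        (∀ a b a' b', TangentPair U D θ ν μ a b → TangentPair U D θ ν μ a' b' →
          a = a' ∧ b = b') ∧
        (0 < ν → Tendsto (deriv D) atTop atTop → ∃ a b, TangentPair U D θ ν μ a b)) ∧
      -- no VaR multiplier
      (lam = 0 →
        -- Case I: `z₁ ≥ 0`
        (∀ z₁ z₂, TangentPair U D θ ν 0 z₁ z₂ → 0 ≤ z₁ →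
          IsSolution f [(G, deriv U (z₂ - θ)), (H, ν * deriv D θ)]) ∧
        -- Case II: `z₁ < 0`
        ((¬ ∃ z₁ z₂, TangentPair U D θ ν 0 z₁ z₂ ∧ 0 ≤ z₁) →
          ∀ z', TangentZero U D θ ν 0 z' →
            IsSolution f [(G, deriv U (z' - θ))])) ∧
      (0 < lam →
        -- `L < z₁`
        (∀ z₁ z₂, TangentPair U D θ ν 0 z₁ z₂ → L < z₁ →
          -- Case III
          (ν * deriv D θ < k →
            IsSolution f [(G, deriv U (z₂ - θ)), (H, ν * deriv D (θ - L)), (C, k)]) ∧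
          -- Case IV
          (k ≤ ν * deriv D θ →
            (∃! z₃, TangentLoss U D θ L ν lam z₃) ∧
            ∀ z₃, TangentLoss U D θ L ν lam z₃ →
              IsSolution f [(G, deriv U (z₂ - θ)), (H, ν * deriv D (θ - L)),
                (C, ν * deriv D (θ - z₃)), (H, ν * deriv D θ)])) ∧
        -- `z₁ ≤ L < θ`
        ((¬ ∃ z₁ z₂, TangentPair U D θ ν 0 z₁ z₂ ∧ L < z₁) → L < θ →
          (∃! z₄, θ < z₄ ∧
            deriv U (z₄ - θ) = (U (z₄ - θ) + ν * D (θ - L)) / (z₄ - L)) ∧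
          ∀ z₄, θ < z₄ → deriv U (z₄ - θ) = (U (z₄ - θ) + ν * D (θ - L)) / (z₄ - L) →
            (ν * deriv D θ < k →
              -- Case V
              (deriv U (z₄ - θ) < k →
                IsSolution f [(G, deriv U (z₄ - θ)), (C, k)]) ∧
              -- Case VI
              (k ≤ deriv U (z₄ - θ) →
                ∀ z₅, TangentZero U D θ ν lam z₅ →
                  IsSolution f [(G, deriv U (z₅ - θ))])) ∧
            (k ≤ ν * deriv D θ →
              (∃! z₃, TangentLoss U D θ L ν lam z₃) ∧
              ∀ z₃, TangentLoss U D θ L ν lam z₃ →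
                -- Case VII
                (deriv U (z₄ - θ) < ν * deriv D (θ - z₃) →
                  IsSolution f [(G, deriv U (z₄ - θ)), (C, ν * deriv D (θ - z₃)),
                    (H, ν * deriv D θ)]) ∧
                (ν * deriv D (θ - z₃) ≤ deriv U (z₄ - θ) →
                  -- Case VIII: `0 < z₆ < L`
                  (∀ z₆ z₇, TangentPair U D θ ν lam z₆ z₇ →
                    z₆ < L ∧
                    (0 < z₆ →
                      IsSolution f [(G, deriv U (z₇ - θ)), (H, ν * deriv D θ)])) ∧
                  -- `z₆ ≤ 0`: solution of Case VI
                  ((¬ ∃ z₆ z₇, TangentPair U D θ ν lam z₆ z₇ ∧ 0 < z₆) →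
                    ∀ z₅, TangentZero U D θ ν lam z₅ →
                      IsSolution f [(G, deriv U (z₅ - θ))])))) ∧
        -- `L = θ`: solution of Case VIII or of Case VI
        (L = θ →
          (∀ z₆ z₇, TangentPair U D θ ν lam z₆ z₇ → 0 < z₆ →
            IsSolution f [(G, deriv U (z₇ - θ)), (H, ν * deriv D θ)]) ∧
          ((¬ ∃ z₆ z₇, TangentPair U D θ ν lam z₆ z₇ ∧ 0 < z₆) →
            ∀ z₅, TangentZero U D θ ν lam z₅ →
              IsSolution f [(G, deriv U (z₅ - θ))])) ∧
        -- `θ < L`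
        (θ < L →
          (∃! z₈, θ < z₈ ∧ z₈ < L ∧
            deriv U (z₈ - θ) = (U (L - θ) + lam - U (z₈ - θ)) / (L - z₈)) ∧
          ∀ z₈, θ < z₈ → z₈ < L →
            deriv U (z₈ - θ) = (U (L - θ) + lam - U (z₈ - θ)) / (L - z₈) →
            (ν * deriv D θ < k →
              -- Case IX
              (k < deriv U (z₈ - θ) → deriv U (L - θ) ≤ k →
                IsSolution f [(G, deriv U (L - θ)), (C, k)]) ∧
              -- Case X
              (k < deriv U (L - θ) →
                ∀ z₉, TangentZero U D θ ν lam z₉ →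
                  L < z₉ ∧ IsSolution f [(G, deriv U (z₉ - θ))]) ∧
              -- Case XI
              (deriv U (z₈ - θ) ≤ k →
                ∀ z₁₀, TangentZero U D θ ν 0 z₁₀ →
                  z₁₀ ≤ z₈ ∧
                  IsSolution f [(G, deriv U (L - θ)), (C, deriv U (z₈ - θ)),
                    (G, deriv U (z₁₀ - θ))])) ∧
            (k ≤ ν * deriv D θ →
              -- `z₁₁`: at most one; it exists iff `ν D'(0+) (L-θ) < U(L-θ) + λ`
              (∀ z w, TangentLoss U D θ L ν lam z → TangentLoss U D θ L ν lam w → z = w) ∧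
              (∀ d, Tendsto (deriv D) (𝓝[>] 0) (𝓝 d) →
                ((∃ z₁₁, TangentLoss U D θ L ν lam z₁₁) ↔
                  ν * d * (L - θ) < U (L - θ) + lam)) ∧
              -- Case XII
              (∀ z₁₁, TangentLoss U D θ L ν lam z₁₁ →
                ν * deriv D (θ - z₁₁) ≤ deriv U (z₈ - θ) →
                deriv U (L - θ) ≤ ν * deriv D (θ - z₁₁) →
                IsSolution f [(G, deriv U (L - θ)), (C, ν * deriv D (θ - z₁₁)),
                  (H, ν * deriv D θ)]) ∧
              -- `z₁₁` does not exist, or `U'(z₈-θ) < ν D'(θ-z₁₁)`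
              ((∀ z₁₁, TangentLoss U D θ L ν lam z₁₁ →
                  deriv U (z₈ - θ) < ν * deriv D (θ - z₁₁)) →
                -- Case XIII: `z₁ ≥ 0`
                (∀ z₁ z₂, TangentPair U D θ ν 0 z₁ z₂ →
                  z₂ < z₈ ∧
                  (0 ≤ z₁ →
                    IsSolution f [(G, deriv U (L - θ)), (C, deriv U (z₈ - θ)),
                      (G, deriv U (z₂ - θ)), (H, ν * deriv D θ)])) ∧
                -- `z₁ < 0`: solution of Case XI
                ((¬ ∃ z₁ z₂, TangentPair U D θ ν 0 z₁ z₂ ∧ 0 ≤ z₁) →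
                  ∀ z₁₀, TangentZero U D θ ν 0 z₁₀ →
                    z₁₀ ≤ z₈ ∧
                    IsSolution f [(G, deriv U (L - θ)), (C, deriv U (z₈ - θ)),
                      (G, deriv U (z₁₀ - θ))])) ∧
              (∀ z₁₁, TangentLoss U D θ L ν lam z₁₁ →
                ν * deriv D (θ - z₁₁) < deriv U (L - θ) →
                -- Case XIV: `z₁₂ > 0`
                (∀ z₁₂ z₁₃, TangentPair U D θ ν lam z₁₂ z₁₃ →
                  L < z₁₃ ∧
                  (0 < z₁₂ →
                    IsSolution f [(G, deriv U (z₁₃ - θ)), (H, ν * deriv D θ)])) ∧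
                -- `z₁₂ ≤ 0`: solution of Case X
                ((¬ ∃ z₁₂ z₁₃, TangentPair U D θ ν lam z₁₂ z₁₃ ∧ 0 < z₁₂) →
                  ∀ z₉, TangentZero U D θ ν lam z₉ →
                    L < z₉ ∧ IsSolution f [(G, deriv U (z₉ - θ))])))))) ∧
    -- concave penalty
    (ConcaveOn ℝ (Ici 0) D →
      ∀ z, TangentZero U D θ ν 0 z →
        (z ≤ L →
          deriv U (L - θ) ≤ k ∧
          -- Case I
          (deriv U (z - θ) < k →
            IsSolution f [(G, deriv U (L - θ)), (C, k)]) ∧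
          -- Case II
          (k ≤ deriv U (z - θ) →
            (∃! L₀, z ≤ L₀ ∧ L₀ ≤ L ∧
              U (L - θ) + lam - U (L₀ - θ) = (L - L₀) * deriv U (L₀ - θ)) ∧
            ∀ L₀, z ≤ L₀ → L₀ ≤ L →
              U (L - θ) + lam - U (L₀ - θ) = (L - L₀) * deriv U (L₀ - θ) →
              IsSolution f [(G, deriv U (L - θ)), (C, deriv U (L₀ - θ)),
                (G, deriv U (z - θ))])) ∧
        (θ ≤ L → L < z →
          -- Case III
          (θ < L → deriv U (L - θ) ≤ k →
            IsSolution f [(G, deriv U (L - θ)), (C, k)]) ∧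
          -- Case IV (`U'(0+) = ∞` when `L = θ`)
          (L = θ ∨ k < deriv U (L - θ) →
            (∃! z₀, L < z₀ ∧ z₀ ≤ z ∧
              U (z₀ - θ) + lam + ν * D θ = z₀ * deriv U (z₀ - θ)) ∧
            ∀ z₀, L < z₀ → z₀ ≤ z →
              U (z₀ - θ) + lam + ν * D θ = z₀ * deriv U (z₀ - θ) →
              IsSolution f [(G, deriv U (z₀ - θ))])) ∧
        (L < θ →
          (∃! w, θ < w ∧ w < z ∧
            U (w - θ) + ν * D (θ - L) = (w - L) * deriv U (w - θ)) ∧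
          ∀ w, θ < w → w < z →
            U (w - θ) + ν * D (θ - L) = (w - L) * deriv U (w - θ) →
            -- Case V
            (deriv U (w - θ) < k →
              IsSolution f [(G, deriv U (w - θ)), (C, k)]) ∧
            -- Case VI
            (k ≤ deriv U (w - θ) →
              (∃! w₀, w ≤ w₀ ∧ w₀ ≤ z ∧
                U (w₀ - θ) + lam + ν * D θ = w₀ * deriv U (w₀ - θ)) ∧
              ∀ w₀, w ≤ w₀ → w₀ ≤ z →
                U (w₀ - θ) + lam + ν * D θ = w₀ * deriv U (w₀ - θ) →
                IsSolution f [(G, deriv U (w₀ - θ))]))) := by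
  subst hf hk hG hH hC
  have h : Market U D θ L ν lam := ⟨hU, hD, hθ, hL, hν, hlam⟩
  refine ⟨fun μ hμ => h.existsUnique_tangentZero hμ, fun hc => ⟨fun μ hμ =>
    ⟨fun a b a' b' hp hp' => hp.unique hU hD hc hν hp', fun hν' htop =>
      exists_tangentPair hU hD hc hν' hμ htop⟩, ?_, fun hlam' => ⟨?_, ?_, ?_, ?_⟩⟩,
    fun hc z hz => ⟨?_, ?_, ?_⟩⟩
  · rintro rfl
    exact ⟨fun a b hp ha => h.convex_lam_zero_pair hc hp ha, fun hno z hz =>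
      h.convex_lam_zero_zero hc hno hz⟩
  · exact fun a b hp hLa => ⟨fun hk => h.convex_low_zero hc rfl hp hLa hk, fun hk =>
      ⟨h.existsUnique_tangentLoss hc hlam' hk (hLa.trans hp.1), fun z hz =>
        h.convex_low_loss hc hp hLa hz⟩⟩
  · intro hno hLθ
    have hiff : ∀ w, (θ < w ∧ deriv U (w - θ) = (U (w - θ) + ν * D (θ - L)) / (w - L)) ↔
        (θ < w ∧ deriv U (w - θ) * (w - L) = U (w - θ) + ν * D (θ - L)) := fun w =>
      and_congr_right fun hw => eq_div_iff (sub_pos.2 (hLθ.trans hw)).ne'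
    simp only [hiff]
    refine ⟨h.existsUnique_tangent_level hLθ, fun w hw hwe => ?_⟩
    have e := ((hiff w).1 ⟨hw, hwe⟩).2
    refine ⟨fun hk => ⟨fun hwk => h.convex_middle_level_zero hc rfl hLθ hno hw e hk hwk,
      fun hkw z hz => h.convex_middle_zero hc rfl hLθ hw e hk hkw hz⟩, fun hk =>
      ⟨h.existsUnique_tangentLoss hc hlam' hk hLθ, fun z hz => ⟨fun hwz =>
        h.convex_middle_level_loss hc (h.nu_pos hlam' hk) hLθ hno hw e hz hwz, fun hzw => ⟨?_, ?_⟩⟩⟩⟩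
    · intro a b hp
      have haL := h.convex_middle_pair_lt hc hlam' hno hp
      exact ⟨haL, fun ha => h.convex_middle_pair hc hLθ hw e hz hzw hp haL ha⟩
    · exact fun hno' z' hz' => h.convex_middle_pair_zero hc hLθ hw e hz hzw hno' hz'
  · exact fun hLθ => ⟨fun a b hp ha => h.convex_eq_pair hc hLθ hp ha, fun hno z hz =>
      h.convex_eq_zero hc hLθ hno hz⟩
  · intro hθL
    refine ⟨h.existsUnique_levelTangent hlam' hθL, fun w hw hwL e => ?_⟩
    rw [eq_div_iff (sub_pos.2 hwL).ne'] at e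
    refine ⟨fun hk => ⟨fun hkw hLk => h.convex_high_level_zero hc rfl hθL hw e hk hkw hLk,
      fun hkL z hz => ?_, fun hwk z hz => ?_⟩, fun hk => ⟨fun z y hz hy =>
        h.tangentLoss_unique hc (h.nu_pos hlam' hk) hz hy, fun d hd =>
        h.exists_tangentLoss_iff hc hlam' hk hθL hd, fun z hz hzw hLz =>
        h.convex_high_level_loss hc (h.nu_pos hlam' hk) hθL hw e hz hzw hLz,
        fun hz => ⟨fun a b hp => ?_, fun hno z hz' => ?_⟩,
        fun z hz hzL => ⟨fun a b hp => ?_, fun hno z' hz' =>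
          h.convex_high_pair_zero hc hθL hz hzL hno hz'⟩⟩⟩
    · have hLz := h.level_lt_tangentZero rfl hθL hkL hz
      exact ⟨hLz, h.convex_high_zero hc rfl hθL hk hLz hz⟩
    · obtain ⟨hzw, hkz⟩ := h.tangentZero_le_levelTangent rfl hw hwL.le e hwk hz
      exact ⟨hzw, h.convex_high_level_gain_zero hc hwL e hz hzw (hk.le.trans hkz)⟩
    · have hbw := h.pair_lt_levelTangent hc hlam' hk hθL hw e hz hp
      exact ⟨hbw, fun ha => h.convex_high_level_gain_pair hc hwL e hp hbw ha⟩
    · have hδ := h.deriv_theta_le hc le_rfl hz' fun ⟨a, b, hp, ha⟩ => hno ⟨a, b, hp, ha.le⟩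
      have hzw := h.tangentZero_le_of_tangentLoss hc hlam' hk hθL hw e hz hz' hδ
      exact ⟨hzw, h.convex_high_level_gain_zero hc hwL e hz' hzw hδ⟩
    · have hLb := h.convex_high_pair_gt hc hθL hz hzL hp
      exact ⟨hLb, fun ha => h.convex_high_pair hc hθL hp hLb ha⟩
  · refine fun hzL => ⟨h.deriv_level_le_kSlope hz hzL, fun hk => h.concave_high hc hz hzL hk,
      fun hk => ⟨h.concave_existsUnique_levelTangent hz hzL hk, fun w hzw hwL e => ?_⟩⟩
    exact h.isSolution_level_levelTangent_zero hz hzw hwL (by linarith) fun x hx hxθ =>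
      h.loss_le_tangentZero hc le_rfl hz hx hxθ.le
  · refine fun hθL hLz => ⟨fun hlt hk => h.concave_middle_level hc hz hlt hLz hk, fun hk => ?_⟩
    obtain ⟨z', hz', huniq⟩ := h.existsUnique_tangentZero hlam
    have hLz' : L < z' := by
      rcases hk with rfl | hk
      · exact hz'.1
      -- If `L = θ`, the value `deriv U 0` in `hk` carries no information, but every tangency point
      -- exceeds `θ` anyway.
      · rcases hθL.eq_or_lt with rfl | hlt
        · exact hz'.1
        · exact h.level_lt_tangentZero rfl hlt hk hz'
    refine ⟨⟨z', ⟨hLz', h.tangentZero_anti hz hz', (h.tangentZero_iff_mul.1 hz').2⟩,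
      fun y hy => huniq y (h.tangentZero_iff_mul.2 ⟨hθL.trans_lt hy.1, hy.2.2⟩)⟩, ?_⟩
    exact fun y hLy _ e => h.concave_isSolution_zero hc hθL
      (h.tangentZero_iff_mul.2 ⟨hθL.trans_lt hLy, e⟩) hLy.le
  · intro hLθ
    obtain ⟨w, ⟨hw, e⟩, huniq⟩ := h.existsUnique_tangent_level hLθ
    refine ⟨⟨w, ⟨hw, h.concave_tangent_level_lt hc hLθ hz e, by linarith⟩,
      fun y hy => huniq y ⟨hy.1, by linarith [hy.2.2]⟩⟩, fun y hy _ ey => ?_⟩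
    obtain rfl := huniq y ⟨hy, by linarith⟩
    refine ⟨fun hk => h.concave_low_level hc hLθ hy e hk, fun hk => ?_⟩
    obtain ⟨z', hz', huniq'⟩ := h.existsUnique_tangentZero hlam
    refine ⟨⟨z', ⟨(h.kSlope_le_of_le_tangent rfl hLθ hy e hk hz').1, h.tangentZero_anti hz hz',
      (h.tangentZero_iff_mul.1 hz').2⟩,
      fun x hx => huniq' x (h.tangentZero_iff_mul.2 ⟨hy.trans_le hx.1, hx.2.2⟩)⟩, ?_⟩
    exact fun x hyx _ ex => h.concave_low_zero hc hLθ hy e hk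
      (h.tangentZero_iff_mul.2 ⟨hy.trans_le hyx, ex⟩)
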